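/- Let $n\ge m\ge 0$ and let $M=\mathrm{M}_{n\times m}(\mathbb{C})$ be the real vector space of complex $n\times m$ matrices with the linear symplectic form $\Omega(E,F)=\operatorname{Im}\operatorname{Tr}(E^\dagger F)$. The left action $E\mapsto UE$ of $\mathrm{U}(n)$ and the right action $E\mapsto EV$ of $\mathrm{U}(m)$ are Hamiltonian, with momentum maps (identifying $\mathfrak{u}(k)^*$ with $\mathfrak{u}(k)$ by the trace form $\operatorname{Re}\operatorname{Tr}(\xi\zeta)$) $$\mathrm{j}_L:M\to\mathfrak{u}(n),\quad \mathrm{j}_L(E)=\tfrac{i}{2}EE^\dagger,\qquad \mathrm{j}_R:M\to\mathfrak{u}(m),\quad \mathrm{j}_R(E)=\tfrac{i}{2}E^\dagger E .$$ For an open set $S\subseteq M$, we say that $\mathrm{j}_L,\mathrm{j}_R$ define a Lie–Weinstein dual pair on $S$ if the images $\mathrm{j}_L(S)$ and $\mathrm{j}_R(S)$ can be given structures of smooth (Hausdorff, second countable) Poisson manifolds such that $\mathrm{j}_L:S\to \mathrm{j}_L(S)$ and $\mathrm{j}_R:S\to \mathrm{j}_R(S)$ are Poisson maps and surjective submersions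 satisfying $$(\ker T_E\,\mathrm{j}_L)^{\Omega}=\ker T_E\,\mathrm{j}_R\qquad\text{for all }E\in S .$$ Let $M^{\mathrm{rk}\,m}\subseteq M$ be the set of matrices of full rank $m$. Then: 1. $M^{\mathrm{rk}\,m}$ is open, and $\mathrm{j}_L,\mathrm{j}_R$ define a Lie–Weinstein dual pair on it. 2. $M^{\mathrm{rk}\,m}$ is the largest such set: every open $S\subseteq M$ on which $\mathrm{j}_L,\mathrm{j}_R$ define a Lie–Weinstein dual pair is contained in $M^{\mathrm{rk}\,m}$. 3. $\mathrm{j}_R$ is (real) differentiable, and the real rank of $T_E\,\mathrm{j}_R:M\to\mathfrak{u}(m)$ equals $m^2=\dim_{\mathbb{R}}\mathfrak{u}(m)$ if $\operatorname{rank}E=m$ and is strictly less than $m^2$ if $\operatorname{rank}E<m$. -/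

import Mathlib

open scoped Manifold ContDiff Matrix

attribute [local instance] Matrix.normedAddCommGroup Matrix.normedSpace

noncomputable section

namespace UnitaryDualPair

/-! ### Symplectic vector spaces and their Poisson bracket -/

/-- A linear symplectic form on a real vector space; a vector space `V` with such a form, and
every open subset of it, is a symplectic manifold, the tangent space at each point being `V`. -/
structure SymplecticForm (V : Type*) [AddCommGroup V] [Module ℝ V] where
  form : LinearMap.BilinForm ℝ V
  isAlt : form.IsAlt
  nondegenerate : form.Nondegenerate

namespace SymplecticForm

variable {V : Type*} [NormedAddCommGroup V] [NormedSpace ℝ V] [FiniteDimensional ℝ V]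

/-- The vector `X_α` with `σ (X_α, w) = α w` for all `w`; the Hamiltonian vector field of `F` is
`x ↦ X_{dF(x)}`. -/
def hamVector (σ : SymplecticForm V) (α : V →L[ℝ] ℝ) : V :=
  (σ.form.toDual σ.nondegenerate).symm (α : V →ₗ[ℝ] ℝ)

theorem form_hamVector (σ : SymplecticForm V) (α : V →L[ℝ] ℝ) (w : V) :
    σ.form (σ.hamVector α) w = α w := by
  simp [hamVector]

/-- The Poisson bracket `{F, G} = σ (X_F, X_G)` of functions on an open subset `U` of the
symplectic vector space. -/
def poissonBracket (σ : SymplecticForm V) {U : TopologicalSpace.Opens V} (F G : U → ℝ) (x : U) :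
    ℝ :=
  σ.form (σ.hamVector (mfderiv 𝓘(ℝ, V) 𝓘(ℝ, ℝ) F x)) (σ.hamVector (mfderiv 𝓘(ℝ, V) 𝓘(ℝ, ℝ) G x))

end SymplecticForm

/-! ### Poisson manifolds -/

/-- A Poisson structure on a smooth `d`-dimensional manifold `P`: a Lie bracket on the smooth
functions that is a derivation in each argument. -/
structure PoissonStructure (d : ℕ) (P : Type*) [TopologicalSpace P]
    [ChartedSpace (EuclideanSpace ℝ (Fin d)) P] where
  bracket : C^∞⟮𝓘(ℝ, EuclideanSpace ℝ (Fin d)), P; ℝ⟯ →ₗ[ℝ]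
    C^∞⟮𝓘(ℝ, EuclideanSpace ℝ (Fin d)), P; ℝ⟯ →ₗ[ℝ] C^∞⟮𝓘(ℝ, EuclideanSpace ℝ (Fin d)), P; ℝ⟯
  bracket_self : ∀ f, bracket f f = 0
  jacobi : ∀ f g h,
    bracket f (bracket g h) + bracket g (bracket h f) + bracket h (bracket f g) = 0
  leibniz : ∀ f g h, bracket f (g * h) = bracket f g * h + g * bracket f h

section DualPair

variable {V : Type*} [NormedAddCommGroup V] [NormedSpace ℝ V] [FiniteDimensional ℝ V]

/-- `J : U → P` is a surjective (smooth) submersion. -/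
def IsSurjectiveSubmersion {U : TopologicalSpace.Opens V} (d : ℕ) {P : Type*} [TopologicalSpace P]
    [ChartedSpace (EuclideanSpace ℝ (Fin d)) P] (J : U → P) : Prop :=
  Function.Surjective J ∧
  ContMDiff 𝓘(ℝ, V) 𝓘(ℝ, EuclideanSpace ℝ (Fin d)) ∞ J ∧
  ∀ x : U, Function.Surjective (mfderiv 𝓘(ℝ, V) 𝓘(ℝ, EuclideanSpace ℝ (Fin d)) J x)

/-- `J : U → P` pulls the Poisson bracket of `P` back to that of `U`. -/
def IsPoissonMap (σ : SymplecticForm V) {U : TopologicalSpace.Opens V} {d : ℕ} {P : Type*}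
    [TopologicalSpace P] [ChartedSpace (EuclideanSpace ℝ (Fin d)) P]
    (π : PoissonStructure d P) (J : U → P) : Prop :=
  ContMDiff 𝓘(ℝ, V) 𝓘(ℝ, EuclideanSpace ℝ (Fin d)) ∞ J ∧
  ∀ (f g : C^∞⟮𝓘(ℝ, EuclideanSpace ℝ (Fin d)), P; ℝ⟯) (x : U),
    π.bracket f g (J x) = σ.poissonBracket (f ∘ J) (g ∘ J) x

/-- The kernel of the tangent map `T_x J`, as a subspace of `T_x U = V`. -/
def kerTangent {U : TopologicalSpace.Opens V} (d : ℕ) {P : Type*} [TopologicalSpace P]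
    [ChartedSpace (EuclideanSpace ℝ (Fin d)) P] (J : U → P) (x : U) : Submodule ℝ V :=
  LinearMap.ker (mfderiv 𝓘(ℝ, V) 𝓘(ℝ, EuclideanSpace ℝ (Fin d)) J x :
    V →L[ℝ] EuclideanSpace ℝ (Fin d)).toLinearMap

/-- `P₁ ← U → P₂` is a Lie–Weinstein dual pair: `P₁`, `P₂` are Poisson manifolds, `J₁`, `J₂` are
Poisson maps and surjective submersions, and `(ker T J₁)^σ = ker T J₂`. -/
def IsLieWeinsteinDualPair (σ : SymplecticForm V) {U : TopologicalSpace.Opens V} {d₁ d₂ : ℕ}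
    {P₁ P₂ : Type*}
    [TopologicalSpace P₁] [ChartedSpace (EuclideanSpace ℝ (Fin d₁)) P₁]
    [TopologicalSpace P₂] [ChartedSpace (EuclideanSpace ℝ (Fin d₂)) P₂]
    (π₁ : PoissonStructure d₁ P₁) (π₂ : PoissonStructure d₂ P₂)
    (J₁ : U → P₁) (J₂ : U → P₂) : Prop :=
  IsPoissonMap σ π₁ J₁ ∧ IsPoissonMap σ π₂ J₂ ∧
  IsSurjectiveSubmersion d₁ J₁ ∧ IsSurjectiveSubmersion d₂ J₂ ∧
  ∀ x : U, σ.form.orthogonal (kerTangent d₁ J₁ x) = kerTangent d₂ J₂ x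

/-- The sets `P₁`, `P₂` can be made into (Hausdorff, second countable, smooth) Poisson manifolds
such that `P₁ ← U → P₂` is a Lie–Weinstein dual pair. -/
def AdmitsLieWeinstein (σ : SymplecticForm V) {U : TopologicalSpace.Opens V} {P₁ P₂ : Type*}
    (J₁ : U → P₁) (J₂ : U → P₂) : Prop :=
  ∃ (d₁ d₂ : ℕ)
    (_ : TopologicalSpace P₁) (_ : T2Space P₁) (_ : SecondCountableTopology P₁)
    (_ : ChartedSpace (EuclideanSpace ℝ (Fin d₁)) P₁)
    (_ : IsManifold 𝓘(ℝ, EuclideanSpace ℝ (Fin d₁)) ∞ P₁)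
    (_ : TopologicalSpace P₂) (_ : T2Space P₂) (_ : SecondCountableTopology P₂)
    (_ : ChartedSpace (EuclideanSpace ℝ (Fin d₂)) P₂)
    (_ : IsManifold 𝓘(ℝ, EuclideanSpace ℝ (Fin d₂)) ∞ P₂)
    (π₁ : PoissonStructure d₁ P₁) (π₂ : PoissonStructure d₂ P₂),
    IsLieWeinsteinDualPair σ π₁ π₂ J₁ J₂

/-- The maps `j₁`, `j₂` define a Lie–Weinstein dual pair `j₁(S) ← S → j₂(S)` on the subset `S`
(which has to be open, so that it is a symplectic manifold of full dimension). -/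
def DefineLieWeinsteinOn (σ : SymplecticForm V) {A B : Type*} (j₁ : V → A) (j₂ : V → B)
    (S : Set V) : Prop :=
  ∃ hS : IsOpen S,
    AdmitsLieWeinstein σ (U := ⟨S, hS⟩) (P₁ := j₁ '' S) (P₂ := j₂ '' S)
      (fun x => ⟨j₁ x, Set.mem_image_of_mem j₁ x.2⟩) (fun x => ⟨j₂ x, Set.mem_image_of_mem j₂ x.2⟩)

end DualPair

/-! ### The matrix space and the two momentum maps -/

/-- The Lie algebra `𝔲(k)` of skew-Hermitian matrices. -/
abbrev Skew (k : ℕ) : Type :=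
  skewAdjoint.submodule ℝ (Matrix (Fin k) (Fin k) ℂ)

/-- `Ω(E, F) = Im Tr (E† F)` as a real bilinear form. -/
def imTraceForm (n m : ℕ) : LinearMap.BilinForm ℝ (Matrix (Fin n) (Fin m) ℂ) :=
  LinearMap.mk₂ ℝ (fun E F => (Eᴴ * F).trace.im)
    (by intro a b c; simp [Matrix.add_mul])
    (by intro r a b; simp)
    (by intro a b c; simp [Matrix.mul_add])
    (by intro r a b; simp)

theorem imTraceForm_apply {n m : ℕ} (E F : Matrix (Fin n) (Fin m) ℂ) :
    imTraceForm n m E F = (Eᴴ * F).trace.im := rfl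

theorem imTraceForm_isAlt (n m : ℕ) : (imTraceForm n m).IsAlt := by
  intro E
  have h : star (Eᴴ * E).trace = (Eᴴ * E).trace := by
    rw [← Matrix.trace_conjTranspose, Matrix.conjTranspose_mul, Matrix.conjTranspose_conjTranspose]
  have h2 : -(Eᴴ * E).trace.im = (Eᴴ * E).trace.im := congrArg Complex.im h
  rw [imTraceForm_apply]
  linarith

open scoped ComplexOrder in
theorem imTraceForm_nondegenerate (n m : ℕ) : (imTraceForm n m).Nondegenerate := by
  have key : ∀ E : Matrix (Fin n) (Fin m) ℂ, (∀ F, imTraceForm n m E F = 0) → E = 0 := by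
    intro E hE
    have h1 := hE (Complex.I • E)
    have h0 : (Eᴴ * E).trace.im = 0 := imTraceForm_isAlt n m E
    have h2 : (Eᴴ * E).trace.re = 0 := by
      simpa [imTraceForm_apply] using h1
    exact Matrix.trace_conjTranspose_mul_self_eq_zero_iff.1 (Complex.ext h2 h0)
  refine ⟨fun E hE => key E hE, fun F hF => key F fun E => ?_⟩
  rw [← (imTraceForm_isAlt n m).neg_eq, hF, neg_zero]

/-- The symplectic form of `M_{n×m}(ℂ)`. -/
def Ω (n m : ℕ) : SymplecticForm (Matrix (Fin n) (Fin m) ℂ) :=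
  ⟨imTraceForm n m, imTraceForm_isAlt n m, imTraceForm_nondegenerate n m⟩

theorem I_half_mem_skew {k l : ℕ} (A : Matrix (Fin k) (Fin l) ℂ) :
    (Complex.I / 2) • (A * Aᴴ) ∈ skewAdjoint.submodule ℝ (Matrix (Fin k) (Fin k) ℂ) := by
  change star ((Complex.I / 2) • (A * Aᴴ)) = -((Complex.I / 2) • (A * Aᴴ))
  rw [Matrix.star_eq_conjTranspose, Matrix.conjTranspose_smul, Matrix.conjTranspose_mul,
    Matrix.conjTranspose_conjTranspose, ← neg_smul]
  congr 1
  simp [neg_div]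

/-- The momentum map `j_L(E) = (i/2) E E†` of the left `U(n)`-action. -/
def jL (n m : ℕ) (E : Matrix (Fin n) (Fin m) ℂ) : Skew n :=
  ⟨(Complex.I / 2) • (E * Eᴴ), I_half_mem_skew E⟩

/-- The momentum map `j_R(E) = (i/2) E† E` of the right `U(m)`-action. -/
def jR (n m : ℕ) (E : Matrix (Fin n) (Fin m) ℂ) : Skew m :=
  ⟨(Complex.I / 2) • (Eᴴ * E), by simpa using I_half_mem_skew Eᴴ⟩

/-- The trace form `⟪ξ, ζ⟫ = Re Tr (ξ ζ)`, which identifies `𝔲(k)` with its dual. -/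
def traceForm {k : ℕ} (ξ ζ : Skew k) : ℝ := ((ξ : Matrix (Fin k) (Fin k) ℂ) * ζ).trace.re

/-- `⟪j_L(E), ζ⟫ = Ω(ζ E, E) / 2`: under the trace form, `j_L` is the (quadratic) momentum map of
the linear Hamiltonian action `E ↦ U E`. -/
theorem traceForm_jL {n m : ℕ} (E : Matrix (Fin n) (Fin m) ℂ) (ζ : Skew n) :
    traceForm (jL n m E) ζ = 1 / 2 * (Ω n m).form ((ζ : Matrix (Fin n) (Fin n) ℂ) * E) E := by
  have hζ : (ζ : Matrix (Fin n) (Fin n) ℂ)ᴴ = -(ζ : Matrix (Fin n) (Fin n) ℂ) := ζ.2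
  have h : (Eᴴ * (ζ : Matrix (Fin n) (Fin n) ℂ) * E).trace
      = (E * Eᴴ * (ζ : Matrix (Fin n) (Fin n) ℂ)).trace := by
    rw [Matrix.trace_mul_comm, ← Matrix.mul_assoc]
  simp only [traceForm, jL, Ω, imTraceForm_apply, Matrix.conjTranspose_mul, hζ, Matrix.mul_neg,
    Matrix.neg_mul, Matrix.trace_neg, h, Matrix.smul_mul, Matrix.trace_smul]
  simp

/-- `⟪j_R(E), ξ⟫ = Ω(E ξ, E) / 2`: under the trace form, `j_R` is the (quadratic) momentum map of
the linear Hamiltonian action `E ↦ E V`. -/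
theorem traceForm_jR {n m : ℕ} (E : Matrix (Fin n) (Fin m) ℂ) (ξ : Skew m) :
    traceForm (jR n m E) ξ = 1 / 2 * (Ω n m).form (E * (ξ : Matrix (Fin m) (Fin m) ℂ)) E := by
  have hξ : (ξ : Matrix (Fin m) (Fin m) ℂ)ᴴ = -(ξ : Matrix (Fin m) (Fin m) ℂ) := ξ.2
  have h : ((ξ : Matrix (Fin m) (Fin m) ℂ) * (Eᴴ * E)).trace
      = (Eᴴ * E * (ξ : Matrix (Fin m) (Fin m) ℂ)).trace := by
    rw [Matrix.trace_mul_comm]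
  simp only [traceForm, jR, Ω, imTraceForm_apply, Matrix.conjTranspose_mul, hξ, Matrix.mul_assoc,
    Matrix.neg_mul, Matrix.trace_neg, Matrix.smul_mul, Matrix.trace_smul]
  rw [Matrix.mul_assoc] at h
  rw [h]
  simp

/-- The set of matrices of rank `m`. -/
def fullRank (n m : ℕ) : Set (Matrix (Fin n) (Fin m) ℂ) := {E | E.rank = m}

/-- The real rank of the tangent map `T_E j_R : M_{n×m}(ℂ) → 𝔲(m)`. -/
def rankTjR (n m : ℕ) (E : Matrix (Fin n) (Fin m) ℂ) : ℕ :=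
  Module.finrank ℝ (LinearMap.range (fderiv ℝ (jR n m) E).toLinearMap)

end UnitaryDualPair

end

/-! On the full-rank set the fibres of both maps are orbits. If x†x = y†y, then xu ↦ yu is an
isometry of the column space of x and extends to a unitary U with Ux = y. If xx† = yy†, then y = xA
with A = (x†x)⁻¹x†y unitary. Both actions are linear and symplectic, so the bracket of two functions
pulled back along `jL` or `jR` is constant on fibres and descends to the image
(`exists_poissonStructure`). The images are manifolds with charts that are linear on the ambient Lie
algebra: `jR` is a submersion into 𝔲(m), and near `jL` T the matrix w is recovered smoothly from
iwT. The kernel of the tangent map of `jL` at E is {Es : s skew-Hermitian}, the tangent space of the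
U(m)-orbit, and its Ω-orthogonal is the kernel for `jR` (`orthogonal_ker_fderiv_jL`).

For maximality the manifold structures on the images are arbitrary, so the kernels cannot be read
off from the matrix derivatives. The fibres, however, are fixed sets, and a linear functional
constant on the fibre of a submersion through E vanishes on the tangent kernel at E
(`eq_zero_of_mfderiv_eq_zero`). If rank E < m ≤ n, choose nonzero columns A, B with E†A = 0 and EB =
0, and put v = AB†. Each y in the `jL`-fibre of E has y†A = 0, so Ω(·, v) vanishes there and v lies
in (ker T`jL`)^Ω = ker T`jR`. Each y in the `jR`-fibre has yB = 0, so Ω(iv, ·) vanishes there. Hence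
Ω(iv, v) = -‖v‖² (Frobenius norm) is zero, contradicting v ≠ 0.

For the rank, T`jR` is onto 𝔲(m) at full rank. If EB = 0 with B ≠ 0, then B†ξB = 0 for all ξ in its
image, which excludes ξ = (i/2)BB†. -/

noncomputable section

namespace UnitaryDualPair

open TopologicalSpace Filter Topology

section Generic

variable {V : Type*} [NormedAddCommGroup V] [NormedSpace ℝ V]
  {F : Type*} [NormedAddCommGroup F] [NormedSpace ℝ F]

set_option linter.unusedSectionVars false

/-! ### Maps out of an open subset of a vector space -/

/-- The extension by zero of a function on an open set. -/
def ext0 {U : Opens V} (f : U → F) : V → F := Function.extend Subtype.val f 0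

@[simp]
theorem ext0_coe {U : Opens V} (f : U → F) (x : U) : ext0 f x = f x :=
  Subtype.val_injective.extend_apply f 0 x

theorem ext0_add {U : Opens V} (f g : U → ℝ) : ext0 (f + g) = ext0 f + ext0 g := by
  simpa [ext0] using Function.extend_add Subtype.val f g (0 : V → ℝ) 0

theorem ext0_mul {U : Opens V} (f g : U → ℝ) : ext0 (f * g) = ext0 f * ext0 g := by
  simpa [ext0] using Function.extend_mul Subtype.val f g (0 : V → ℝ) 0

theorem ext0_smul {U : Opens V} (c : ℝ) (f : U → ℝ) : ext0 (c • f) = c • ext0 f := by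
  simpa [ext0] using Function.extend_smul c Subtype.val f (0 : V → ℝ)

variable {P : Type*} [TopologicalSpace P] [ChartedSpace F P]

theorem contMDiffAt_coe_iff {U : Opens V} {n : ℕ∞ω} (g : V → F) (x : U) :
    ContMDiffAt 𝓘(ℝ, V) 𝓘(ℝ, F) n (fun y : U => g y) x ↔ ContDiffAt ℝ n g x := by
  rw [contMDiffAt_subtype_iff, contMDiffAt_iff_contDiffAt]

theorem contDiffAt_ext0 {U : Opens V} {n : ℕ∞ω} {f : U → F} {x : U}
    (hf : ContMDiffAt 𝓘(ℝ, V) 𝓘(ℝ, F) n f x) : ContDiffAt ℝ n (ext0 f) x := by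
  rw [← contMDiffAt_coe_iff]
  simpa using hf

/-- The tangent map of `J : U → P` is the derivative of its expression in the chart of `P`. -/
theorem mfderiv_eq_fderiv {U : Opens V} {J : U → P} {x : U}
    (hJ : MDifferentiableAt 𝓘(ℝ, V) 𝓘(ℝ, F) J x) (g : V → F)
    (hg : ∀ y : U, chartAt F (J x) (J y) = g y) :
    (mfderiv 𝓘(ℝ, V) 𝓘(ℝ, F) J x : V →L[ℝ] F) = fderiv ℝ g x := by
  refine hJ.mfderiv.trans ?_
  change fderivWithin ℝ (writtenInExtChartAt 𝓘(ℝ, V) 𝓘(ℝ, F) x J) _ _ = _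
  have hx (y : U) : extChartAt 𝓘(ℝ, V) x y = (y : V) := rfl
  rw [hx, modelWithCornersSelf_coe, Set.range_id, fderivWithin_univ]
  apply Filter.EventuallyEq.fderiv_eq
  filter_upwards [U.isOpen.mem_nhds x.2] with y hy
  have h2 : (extChartAt 𝓘(ℝ, V) x).symm y = ⟨y, hy⟩ := by
    have h := (extChartAt 𝓘(ℝ, V) x).left_inv (x := ⟨y, hy⟩) (by
      rw [extChartAt_source, Opens.chartAt_eq]
      exact ⟨trivial, trivial⟩)
    rwa [hx] at h
  simp only [writtenInExtChartAt, Function.comp_apply, h2]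
  exact hg _

theorem mfderiv_real_eq_fderiv {U : Opens V} {f : U → ℝ} {x : U}
    (hf : MDifferentiableAt 𝓘(ℝ, V) 𝓘(ℝ, ℝ) f x) :
    (mfderiv 𝓘(ℝ, V) 𝓘(ℝ, ℝ) f x : V →L[ℝ] ℝ) = fderiv ℝ (ext0 f) x :=
  mfderiv_eq_fderiv hf _ fun y => (ext0_coe f y).symm

/-- The expression of `J : U → P` in the chart of `P` at `J x`. -/
def chartExpr {U : Opens V} (J : U → P) (x : U) : V → F :=
  ext0 fun y => chartAt F (J x) (J y)

theorem chartExpr_coe {U : Opens V} (J : U → P) (x y : U) :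
    chartExpr J x y = chartAt F (J x) (J y) :=
  ext0_coe _ y

theorem mfderiv_eq_fderiv_chartExpr {U : Opens V} {J : U → P} {x : U}
    (hJ : MDifferentiableAt 𝓘(ℝ, V) 𝓘(ℝ, F) J x) :
    (mfderiv 𝓘(ℝ, V) 𝓘(ℝ, F) J x : V →L[ℝ] F) = fderiv ℝ (chartExpr (F := F) J x) x :=
  mfderiv_eq_fderiv hJ _ fun y => (chartExpr_coe J x y).symm

theorem contDiffAt_chartExpr [IsManifold 𝓘(ℝ, F) ∞ P] {U : Opens V} {J : U → P} {x : U}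
    (hJ : ContMDiffAt 𝓘(ℝ, V) 𝓘(ℝ, F) ∞ J x) : ContDiffAt ℝ ∞ (chartExpr (F := F) J x) x := by
  apply contDiffAt_ext0
  have h := (contMDiffAt_iff_target.1 hJ).2
  simpa [Function.comp_def] using h

/-! ### Submersions: Lagrange multipliers, local sections, descent of smoothness -/

/-- A linear functional which is constant on the fibre of a submersion through a point vanishes on
the kernel of the tangent map at this point. -/
theorem eq_zero_of_mfderiv_eq_zero [CompleteSpace V] [CompleteSpace F]
    [IsManifold 𝓘(ℝ, F) ∞ P] {U : Opens V} {J : U → P} {x : U}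
    (hJ : ContMDiffAt 𝓘(ℝ, V) 𝓘(ℝ, F) ∞ J x)
    (hsurj : Function.Surjective (mfderiv 𝓘(ℝ, V) 𝓘(ℝ, F) J x : V →L[ℝ] F))
    (φ : V →L[ℝ] ℝ) (hφ : ∀ y : U, J y = J x → φ y = φ x)
    {w : V} (hw : (mfderiv 𝓘(ℝ, V) 𝓘(ℝ, F) J x : V →L[ℝ] F) w = 0) : φ w = 0 := by
  have hmd := mfderiv_eq_fderiv_chartExpr (hJ.mdifferentiableAt (by simp))
  rw [hmd] at hsurj hw
  have hg := (contDiffAt_chartExpr hJ).hasStrictFDerivAt (by simp)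
  have hcont : ∀ᶠ y in 𝓝 x, J y ∈ (chartAt F (J x)).source :=
    hJ.continuousAt ((chartAt F (J x)).open_source.mem_nhds (mem_chart_source F (J x)))
  -- The chart is injective only on its source, so a level set of the chart expression is a fibre of
  -- `J` only near `x`.
  have hev : ∀ᶠ y in 𝓝 (x : V), chartExpr (F := F) J x y = chartExpr (F := F) J x x → φ y = φ x := by
    rw [← U.isOpen.isOpenEmbedding_subtypeVal.map_nhds_eq x, eventually_map]
    filter_upwards [hcont] with y hy h
    rw [chartExpr_coe, chartExpr_coe] at h
    exact hφ y ((chartAt F (J x)).injOn hy (mem_chart_source F (J x)) h)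
  have hext : IsLocalExtrOn φ {y | chartExpr (F := F) J x y = chartExpr (F := F) J x x} (x : V) := by
    left
    filter_upwards [hev.filter_mono nhdsWithin_le_nhds, self_mem_nhdsWithin] with y h1 h2
    exact (h1 h2).ge
  -- Lagrange multipliers: Λ ∘ dg + Λ₀ φ = 0 with (Λ, Λ₀) ≠ 0. Surjectivity of dg forces Λ₀ ≠ 0, so
  -- φ vanishes on ker dg.
  obtain ⟨Λ, Λ₀, hne, h⟩ :=
    hext.exists_linear_map_of_hasStrictFDerivAt hg φ.hasStrictFDerivAt
  have hΛ₀ : Λ₀ ≠ 0 := by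
    rintro rfl
    apply hne
    have : Λ = 0 := by
      ext y
      obtain ⟨v, rfl⟩ := hsurj y
      have := h v
      rw [zero_smul, add_zero] at this
      exact this
    rw [this]; rfl
  have h3 := h w
  have hw' : fderiv ℝ (chartExpr (F := F) J x) x w = 0 := hw
  rw [hw', map_zero, zero_add, smul_eq_mul] at h3
  exact (mul_eq_zero.1 h3).resolve_left hΛ₀

/-- A smooth map with surjective derivative at a point has a smooth right inverse. -/
theorem exists_right_inverse_of_surjective [CompleteSpace V] [FiniteDimensional ℝ F]
    {g : V → F} {x : V} (hg : ContDiffAt ℝ ∞ g x) (hsurj : Function.Surjective (fderiv ℝ g x)) :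
    ∃ s : F → V, ContDiffAt ℝ ∞ s (g x) ∧ s (g x) = x ∧ ∀ᶠ q in 𝓝 (g x), g (s q) = q := by
  obtain ⟨R, hR⟩ := (fderiv ℝ g x).toLinearMap.exists_rightInverse_of_surjective
    (LinearMap.range_eq_top.2 hsurj)
  have : CompleteSpace F := FiniteDimensional.complete ℝ F
  let R' : F →L[ℝ] V := LinearMap.toContinuousLinearMap R
  -- The restriction of `g` to the affine slice x + R(F), R a linear right inverse of dg, has
  -- derivative the identity at 0, so the inverse function theorem applies.
  let h : F → F := fun q => g (x + R' q)
  have hg0 : ContDiffAt ℝ ∞ g (x + R' 0) := by simpa using hg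
  have hh : ContDiffAt ℝ ∞ h 0 :=
    ContDiffAt.comp (0 : F) hg0 (contDiffAt_const.add R'.contDiff.contDiffAt)
  have hh' : HasFDerivAt h ((ContinuousLinearEquiv.refl ℝ F : F ≃L[ℝ] F) : F →L[ℝ] F) 0 := by
    have h1 : HasFDerivAt g (fderiv ℝ g x) (x + R' 0) := by
      simpa using (hg.differentiableAt (by simp)).hasFDerivAt
    have h2 := h1.comp (0 : F) (R'.hasFDerivAt.const_add x)
    refine h2.congr_fderiv ?_
    ext q
    exact LinearMap.congr_fun hR q
  have h0 : h 0 = g x := by simp [h]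
  let φ := hh.localInverse hh' (by simp)
  have hφ : ContDiffAt ℝ ∞ φ (g x) := h0 ▸ hh.to_localInverse hh' (by simp)
  have hstrict := hh.hasStrictFDerivAt' hh' (by simp)
  have hφ0 : φ (g x) = 0 := by
    have := hh.localInverse_apply_image hh' (by simp)
    rwa [h0] at this
  refine ⟨fun q => x + R' (φ q), contDiffAt_const.add (R'.contDiff.contDiffAt.comp _ hφ),
    by simp [hφ0], ?_⟩
  have := hstrict.eventually_right_inverse
  rw [h0] at this
  exact this

/-- Smoothness descends along submersions. -/
theorem contMDiff_of_comp_submersion [CompleteSpace V] [FiniteDimensional ℝ F]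
    [IsManifold 𝓘(ℝ, F) ∞ P] {U : Opens V} {J : U → P} (hJs : Function.Surjective J)
    (hJ : ContMDiff 𝓘(ℝ, V) 𝓘(ℝ, F) ∞ J)
    (hsurj : ∀ x, Function.Surjective (mfderiv 𝓘(ℝ, V) 𝓘(ℝ, F) J x : V →L[ℝ] F))
    {h : P → ℝ} (hh : ContMDiff 𝓘(ℝ, V) 𝓘(ℝ, ℝ) ∞ (h ∘ J)) :
    ContMDiff 𝓘(ℝ, F) 𝓘(ℝ, ℝ) ∞ h := by
  intro p
  obtain ⟨x, rfl⟩ := hJs p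
  have hsx := hsurj x
  rw [mfderiv_eq_fderiv_chartExpr ((hJ x).mdifferentiableAt (by simp))] at hsx
  obtain ⟨s, hs, hs0, hsg⟩ := exists_right_inverse_of_surjective (contDiffAt_chartExpr (hJ x)) hsx
  rw [chartExpr_coe] at hs hs0 hsg
  have he : ContMDiffAt 𝓘(ℝ, F) 𝓘(ℝ, F) ∞ (chartAt F (J x)) (J x) := by
    simpa using contMDiffAt_extChartAt (I := 𝓘(ℝ, F)) (n := ∞) (x := J x)
  have hH : ContDiffAt ℝ ∞ (ext0 (h ∘ J)) (s (chartAt F (J x) (J x))) := by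
    rw [hs0]; exact contDiffAt_ext0 (hh x)
  -- Near `J x`, `h` equals (h ∘ J) ∘ s ∘ chart for a smooth local section `s` of the chart
  -- expression.
  have hcomp : ContMDiffAt 𝓘(ℝ, F) 𝓘(ℝ, ℝ) ∞
      (fun p => ext0 (h ∘ J) (s (chartAt F (J x) p))) (J x) :=
    (hH.comp _ hs).contMDiffAt.comp (J x) he
  refine hcomp.congr_of_eventuallyEq ?_
  have hsc : ContinuousAt (fun p => s (chartAt F (J x) p)) (J x) :=
    ContinuousAt.comp hs.continuousAt he.continuousAt
  have hJc : ∀ᶠ y in 𝓝 (x : V), ∃ hy : y ∈ U, J ⟨y, hy⟩ ∈ (chartAt F (J x)).source := by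
    rw [← U.isOpen.isOpenEmbedding_subtypeVal.map_nhds_eq x, eventually_map]
    filter_upwards [(hJ x).continuousAt
      ((chartAt F (J x)).open_source.mem_nhds (mem_chart_source F (J x)))] with y hy
    exact ⟨y.2, hy⟩
  rw [← hs0] at hJc
  filter_upwards [hsc.eventually hJc, he.continuousAt.eventually hsg,
    (chartAt F (J x)).open_source.mem_nhds (mem_chart_source F (J x))] with p ⟨h1, h2⟩ h3 h4
  have h5 : chartExpr (F := F) J x (⟨_, h1⟩ : U) = chartAt F (J x) p := h3
  rw [chartExpr_coe] at h5
  have h6 := (chartAt F (J x)).injOn h2 h4 h5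
  have h7 := ext0_coe (h ∘ J) ⟨_, h1⟩
  simp only [Function.comp_apply, h6] at h7
  exact h7.symm

end Generic

end UnitaryDualPair

namespace UnitaryDualPair

open TopologicalSpace Filter Topology

section Bracket

variable {V : Type*} [NormedAddCommGroup V] [NormedSpace ℝ V] [FiniteDimensional ℝ V]

/-! ### The Poisson bracket of a symplectic vector space -/

namespace SymplecticForm

/-- The map `α ↦ X_α` as a continuous linear map. -/
def hamL (σ : SymplecticForm V) : (V →L[ℝ] ℝ) →L[ℝ] V :=
  LinearMap.toContinuousLinearMap
    ((σ.form.toDual σ.nondegenerate).symm.toLinearMap ∘ₗ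
      (ContinuousLinearMap.coeLM ℝ : (V →L[ℝ] ℝ) →ₗ[ℝ] (V →ₗ[ℝ] ℝ)))

theorem form_hamL (σ : SymplecticForm V) (α : V →L[ℝ] ℝ) (w : V) : σ.form (σ.hamL α) w = α w :=
  σ.form_hamVector α w

theorem apply_hamL_comm (σ : SymplecticForm V) (α β : V →L[ℝ] ℝ) :
    α (σ.hamL β) = -β (σ.hamL α) := by
  rw [← σ.form_hamL α, ← σ.form_hamL β, σ.isAlt.neg_eq]

/-- The Poisson bracket of functions on the whole symplectic vector space. -/
def pb (σ : SymplecticForm V) (f g : V → ℝ) (x : V) : ℝ :=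
  fderiv ℝ f x (σ.hamL (fderiv ℝ g x))

theorem pb_self (σ : SymplecticForm V) (f : V → ℝ) (x : V) : σ.pb f f x = 0 := by
  have := σ.apply_hamL_comm (fderiv ℝ f x) (fderiv ℝ f x)
  rw [pb]
  linarith

theorem pb_comm (σ : SymplecticForm V) (f g : V → ℝ) (x : V) : σ.pb f g x = -σ.pb g f x :=
  σ.apply_hamL_comm _ _

theorem pb_congr_right (σ : SymplecticForm V) (f : V → ℝ) {g g' : V → ℝ} {x : V}
    (h : g =ᶠ[𝓝 x] g') : σ.pb f g x = σ.pb f g' x := by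
  rw [pb, pb, h.fderiv_eq]

theorem pb_add_right (σ : SymplecticForm V) (f : V → ℝ) {g h : V → ℝ} {x : V}
    (hg : DifferentiableAt ℝ g x) (hh : DifferentiableAt ℝ h x) :
    σ.pb f (g + h) x = σ.pb f g x + σ.pb f h x := by
  rw [pb, fderiv_add hg hh, map_add, map_add]; rfl

theorem pb_smul_right (σ : SymplecticForm V) (f : V → ℝ) (c : ℝ) {g : V → ℝ} {x : V}
    (hg : DifferentiableAt ℝ g x) : σ.pb f (c • g) x = c * σ.pb f g x := by
  rw [pb, fderiv_const_smul hg, map_smul, map_smul]; rfl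

theorem pb_mul_right (σ : SymplecticForm V) (f : V → ℝ) {g h : V → ℝ} {x : V}
    (hg : DifferentiableAt ℝ g x) (hh : DifferentiableAt ℝ h x) :
    σ.pb f (g * h) x = σ.pb f g x * h x + g x * σ.pb f h x := by
  rw [pb, fderiv_mul hg hh, map_add, map_add, map_smul, map_smul, map_smul, map_smul, add_comm,
    smul_eq_mul, smul_eq_mul, mul_comm (h x)]
  rfl

theorem contDiffAt_pb (σ : SymplecticForm V) {f g : V → ℝ} {x : V} (hf : ContDiffAt ℝ ∞ f x)
    (hg : ContDiffAt ℝ ∞ g x) : ContDiffAt ℝ ∞ (σ.pb f g) x := by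
  have hf' : ContDiffAt ℝ ∞ (fderiv ℝ f) x := hf.fderiv_right (by simp)
  have hg' : ContDiffAt ℝ ∞ (fderiv ℝ g) x := hg.fderiv_right (by simp)
  exact hf'.clm_apply (σ.hamL.contDiff.contDiffAt.comp x hg')

/-- The product rule applied to df(X_g) leaves a term df(X_β) with β = D²g(v, ·); skewness turns it
into -D²g(v, X_f), so only Hessians on Hamiltonian vectors remain. -/
theorem fderiv_pb (σ : SymplecticForm V) {f g : V → ℝ} {x : V} (hf : ContDiffAt ℝ ∞ f x)
    (hg : ContDiffAt ℝ ∞ g x) (v : V) :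
    fderiv ℝ (σ.pb f g) x v =
      fderiv ℝ (fderiv ℝ f) x v (σ.hamL (fderiv ℝ g x)) -
      fderiv ℝ (fderiv ℝ g) x v (σ.hamL (fderiv ℝ f x)) := by
  have hf' : ContDiffAt ℝ ∞ (fderiv ℝ f) x := hf.fderiv_right (by simp)
  have hg' : ContDiffAt ℝ ∞ (fderiv ℝ g) x := hg.fderiv_right (by simp)
  have h1 := (hf'.differentiableAt (by simp)).hasFDerivAt
  have h2 := σ.hamL.hasFDerivAt.comp x (hg'.differentiableAt (by simp)).hasFDerivAt
  have h3 : HasFDerivAt (σ.pb f g) _ x := h1.clm_apply h2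
  rw [h3.fderiv]
  simp only [add_apply, ContinuousLinearMap.comp_apply,
    ContinuousLinearMap.flip_apply]
  rw [σ.apply_hamL_comm (fderiv ℝ f x)]
  ring

/-- The form is constant, so the cyclic sum consists of Hessian terms only: each of D²f, D²g, D²h
occurs twice with opposite signs, and symmetry cancels them. -/
theorem pb_jacobi (σ : SymplecticForm V) {f g h : V → ℝ} {x : V} (hf : ContDiffAt ℝ ∞ f x)
    (hg : ContDiffAt ℝ ∞ g x) (hh : ContDiffAt ℝ ∞ h x) :
    σ.pb f (σ.pb g h) x + σ.pb g (σ.pb h f) x + σ.pb h (σ.pb f g) x = 0 := by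
  have hs : ∀ {k : V → ℝ}, ContDiffAt ℝ ∞ k x → ∀ v w,
      fderiv ℝ (fderiv ℝ k) x v w = fderiv ℝ (fderiv ℝ k) x w v := fun hk v w =>
    (hk.isSymmSndFDerivAt (by
      rw [minSmoothness_of_isRCLikeNormedField]; exact WithTop.coe_le_coe.2 le_top)) v w
  rw [σ.pb_comm f, σ.pb_comm g, σ.pb_comm h]
  simp only [pb, fderiv_pb σ hg hh, fderiv_pb σ hh hf, fderiv_pb σ hf hg]
  rw [hs hf (σ.hamL (fderiv ℝ g x)), hs hg (σ.hamL (fderiv ℝ f x)),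
    hs hh (σ.hamL (fderiv ℝ f x))]
  ring

theorem poissonBracket_eq_pb (σ : SymplecticForm V) {U : Opens V} {f g : U → ℝ} {x : U}
    (hf : MDifferentiableAt 𝓘(ℝ, V) 𝓘(ℝ, ℝ) f x) (hg : MDifferentiableAt 𝓘(ℝ, V) 𝓘(ℝ, ℝ) g x) :
    σ.poissonBracket f g x = σ.pb (ext0 f) (ext0 g) x := by
  have h := σ.form_hamVector (mfderiv 𝓘(ℝ, V) 𝓘(ℝ, ℝ) f x : V →L[ℝ] ℝ)
    (σ.hamVector (mfderiv 𝓘(ℝ, V) 𝓘(ℝ, ℝ) g x : V →L[ℝ] ℝ))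
  refine h.trans ?_
  rw [mfderiv_real_eq_fderiv hf, mfderiv_real_eq_fderiv hg]
  rfl

/-- The bracket is invariant under linear symplectic automorphisms. -/
theorem pb_comp_equiv (σ : SymplecticForm V) (Φ : V ≃L[ℝ] V)
    (hΦ : ∀ v w, σ.form (Φ v) (Φ w) = σ.form v w) {f g : V → ℝ} (x : V)
    (hf : f ∘ Φ = f) (hg : g ∘ Φ = g) : σ.pb f g (Φ x) = σ.pb f g x := by
  -- The chain rule for a linear equivalence needs no differentiability of `k`, so the invariance
  -- holds for arbitrary functions.
  have key : ∀ k : V → ℝ, k ∘ Φ = k → ∀ v, fderiv ℝ k x v = fderiv ℝ k (Φ x) (Φ v) := by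
    intro k hk v
    have := Φ.comp_right_fderiv (f := k) (x := x)
    rw [hk] at this
    rw [this]; rfl
  have hX : Φ (σ.hamL (fderiv ℝ g x)) = σ.hamL (fderiv ℝ g (Φ x)) := by
    have : ∀ w, σ.form (Φ (σ.hamL (fderiv ℝ g x))) w = σ.form (σ.hamL (fderiv ℝ g (Φ x))) w := by
      intro w
      obtain ⟨v, rfl⟩ := Φ.surjective w
      rw [hΦ, form_hamL, form_hamL, key g hg]
    rw [← sub_eq_zero]
    apply σ.nondegenerate.1
    intro w
    simp [this]
  rw [pb, pb, key f hf, hX]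

end SymplecticForm

/-! ### Descending the bracket along a submersion -/

/-- The Poisson structure on the base of a surjective submersion from an open subset of a
symplectic vector space, when brackets of pulled back functions are constant on the fibres. -/
theorem exists_poissonStructure (σ : SymplecticForm V) {U : Opens V} {d : ℕ} {P : Type*}
    [TopologicalSpace P] [ChartedSpace (EuclideanSpace ℝ (Fin d)) P]
    [IsManifold 𝓘(ℝ, EuclideanSpace ℝ (Fin d)) ∞ P] {J : U → P}
    (hJ : IsSurjectiveSubmersion d J)
    (hconst : ∀ f g : P → ℝ, ∀ x y : U, J x = J y →
      σ.pb (ext0 (f ∘ J)) (ext0 (g ∘ J)) x = σ.pb (ext0 (f ∘ J)) (ext0 (g ∘ J)) y) :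
    ∃ π : PoissonStructure d P, IsPoissonMap σ π J := by
  obtain ⟨hsurj, hsm, hsub⟩ := hJ
  let C := C^∞⟮𝓘(ℝ, EuclideanSpace ℝ (Fin d)), P; ℝ⟯
  have hFm (f : C) : ContMDiff 𝓘(ℝ, V) 𝓘(ℝ, ℝ) ∞ (f ∘ J) := f.contMDiff.comp hsm
  have hF (f : C) (x : U) : ContDiffAt ℝ ∞ (ext0 (f ∘ J)) x := contDiffAt_ext0 (hFm f x)
  have hFd (f : C) (x : U) : DifferentiableAt ℝ (ext0 (f ∘ J)) x :=
    (hF f x).differentiableAt (by simp)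
  -- The bracket at `p` is evaluated at an arbitrary preimage of `p`; `hconst` makes the choice
  -- irrelevant.
  let b (f g : C) (p : P) : ℝ :=
    σ.pb (ext0 (f ∘ J)) (ext0 (g ∘ J)) (Function.surjInv hsurj p : U)
  have hb (f g : C) (x : U) : b f g (J x) = σ.pb (ext0 (f ∘ J)) (ext0 (g ∘ J)) x :=
    hconst f g _ x (Function.surjInv_eq hsurj (J x))
  have hbJ (f g : C) : b f g ∘ J = fun x : U => σ.pb (ext0 (f ∘ J)) (ext0 (g ∘ J)) x :=
    funext (hb f g)
  have hbs (f g : C) : ContMDiff 𝓘(ℝ, EuclideanSpace ℝ (Fin d)) 𝓘(ℝ, ℝ) ∞ (b f g) := by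
    refine contMDiff_of_comp_submersion hsurj hsm hsub ?_
    rw [hbJ]
    exact fun x => (contMDiffAt_coe_iff _ x).2 (σ.contDiffAt_pb (hF f x) (hF g x))
  let B (f g : C) : C := ⟨b f g, hbs f g⟩
  have hB (f g : C) (x : U) : B f g (J x) = σ.pb (ext0 (f ∘ J)) (ext0 (g ∘ J)) x := hb f g x
  have hBext (f g : C) (x : U) :
      ext0 (B f g ∘ J) =ᶠ[𝓝 (x : V)] σ.pb (ext0 (f ∘ J)) (ext0 (g ∘ J)) := by
    filter_upwards [U.isOpen.mem_nhds x.2] with y hy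
    have := ext0_coe (B f g ∘ J) (⟨y, hy⟩ : U)
    rw [this]
    exact hB f g ⟨y, hy⟩
  have hext {f g : C} (h : ∀ x, f (J x) = g (J x)) : f = g := by
    ext p
    obtain ⟨x, rfl⟩ := hsurj p
    exact h x
  have hskew (f g : C) : B f g = -B g f := hext fun x => by
    rw [ContMDiffMap.coe_neg, Pi.neg_apply, hB, hB, σ.pb_comm]
  have hadd (f g h : C) : B f (g + h) = B f g + B f h := hext fun x => by
    rw [ContMDiffMap.coe_add, Pi.add_apply, hB, hB, hB]
    have : ((g + h : C) : P → ℝ) ∘ J = g ∘ J + h ∘ J := rfl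
    rw [this, ext0_add, σ.pb_add_right _ (hFd g x) (hFd h x)]
  have hsmul (c : ℝ) (f g : C) : B f (c • g) = c • B f g := hext fun x => by
    rw [ContMDiffMap.coe_smul, Pi.smul_apply, hB, hB]
    have : ((c • g : C) : P → ℝ) ∘ J = c • (g ∘ J) := rfl
    rw [this, ext0_smul, σ.pb_smul_right _ _ (hFd g x), smul_eq_mul]
  refine ⟨⟨LinearMap.mk₂ ℝ B ?_ ?_ hadd hsmul, ?_, ?_, ?_⟩, hsm, ?_⟩
  · intro f g h
    rw [hskew, hadd, hskew f, hskew g, neg_add]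
  · intro c f g
    rw [hskew, hsmul, hskew f, smul_neg]
  · intro f
    exact hext fun x => (hB f f x).trans (σ.pb_self _ _)
  · intro f g h
    refine hext fun x => ?_
    simp only [LinearMap.mk₂_apply]
    rw [ContMDiffMap.coe_add, ContMDiffMap.coe_add, Pi.add_apply, Pi.add_apply, hB, hB, hB,
      σ.pb_congr_right _ (hBext g h x), σ.pb_congr_right _ (hBext h f x),
      σ.pb_congr_right _ (hBext f g x), σ.pb_jacobi (hF f x) (hF g x) (hF h x)]
    rfl
  · intro f g h
    refine hext fun x => ?_
    simp only [LinearMap.mk₂_apply]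
    rw [ContMDiffMap.coe_add, ContMDiffMap.coe_mul, ContMDiffMap.coe_mul, Pi.add_apply,
      Pi.mul_apply, Pi.mul_apply, hB, hB, hB]
    have : ((g * h : C) : P → ℝ) ∘ J = (g ∘ J) * (h ∘ J) := rfl
    rw [this, ext0_mul, σ.pb_mul_right _ (hFd g x) (hFd h x), ext0_coe, ext0_coe]
    rfl
  · intro f g x
    simp only [LinearMap.mk₂_apply]
    rw [hB, σ.poissonBracket_eq_pb ((hFm f x).mdifferentiableAt (by simp))
      ((hFm g x).mdifferentiableAt (by simp))]

end Bracket

end UnitaryDualPair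

namespace UnitaryDualPair

open TopologicalSpace Filter Topology

section Image

variable {V : Type*} [NormedAddCommGroup V] [NormedSpace ℝ V] [FiniteDimensional ℝ V]
  {W : Type*} [NormedAddCommGroup W] [NormedSpace ℝ W]

set_option linter.unusedSectionVars false

/-! ### The image of a map as an embedded submanifold -/

/-- A chart of the image `j(U)` near `j x` obtained by restricting a linear map on the ambient
space. -/
structure ImageChart (j : V → W) (U : Opens V) (d : ℕ) (x : V) where
  lin : W →L[ℝ] EuclideanSpace ℝ (Fin d)
  dom : Set W
  inv : EuclideanSpace ℝ (Fin d) → W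
  isOpen_dom : IsOpen dom
  mem_dom : j x ∈ dom
  inv_lin : ∀ y ∈ U, j y ∈ dom → inv (lin (j y)) = j y
  contDiffAt_inv : ∀ y ∈ U, j y ∈ dom → ContDiffAt ℝ ∞ inv (lin (j y))
  surjective : ∀ y ∈ U, j y ∈ dom → Function.Surjective fun v => lin (fderiv ℝ j y v)

namespace ImageChart

variable {j : V → W} {U : Opens V} {d : ℕ} {x : V}

/-- The image in the model space of the part of `j(U)` covered by the chart. -/
def target (c : ImageChart j U d x) : Set (EuclideanSpace ℝ (Fin d)) :=
  c.lin ∘ j '' (U ∩ j ⁻¹' c.dom)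

/-- `lin ∘ j` is a submersion at every point covered by the chart, hence open there. -/
theorem isOpen_target (c : ImageChart j U d x) (hj : ContDiff ℝ ∞ j) : IsOpen c.target := by
  rw [isOpen_iff_mem_nhds]
  rintro _ ⟨y, ⟨hyU, hyd⟩, rfl⟩
  have h1 : HasStrictFDerivAt (c.lin ∘ j) (c.lin ∘L fderiv ℝ j y) y :=
    c.lin.hasStrictFDerivAt.comp y (hj.contDiffAt.hasStrictFDerivAt (by simp))
  rw [← h1.map_nhds_eq_of_surj (LinearMap.range_eq_top.2 (c.surjective y hyU hyd))]
  exact image_mem_map (((U.isOpen.inter (c.isOpen_dom.preimage hj.continuous)).mem_nhds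
    ⟨hyU, hyd⟩))

theorem inv_of_mem_target (c : ImageChart j U d x) {q : EuclideanSpace ℝ (Fin d)}
    (hq : q ∈ c.target) :
    c.inv q ∈ j '' U ∧ c.inv q ∈ c.dom ∧ c.lin (c.inv q) = q ∧ ContDiffAt ℝ ∞ c.inv q := by
  obtain ⟨y, ⟨hyU, hyd⟩, rfl⟩ := hq
  simp only [Function.comp_apply, c.inv_lin y hyU hyd]
  exact ⟨⟨y, hyU, rfl⟩, hyd, trivial, c.contDiffAt_inv y hyU hyd⟩

open Classical in
/-- The chart of `j(U)` as a partial homeomorphism. -/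
def toChart (c : ImageChart j U d x) (hj : ContDiff ℝ ∞ j) (hx : x ∈ U) :
    OpenPartialHomeomorph (j '' (U : Set V)) (EuclideanSpace ℝ (Fin d)) where
  toFun p := c.lin p
  invFun q := if h : c.inv q ∈ j '' U then ⟨c.inv q, h⟩ else ⟨j x, x, hx, rfl⟩
  source := Subtype.val ⁻¹' c.dom
  target := c.target
  map_source' := by
    rintro ⟨_, y, hy, rfl⟩ hp
    exact ⟨y, ⟨hy, hp⟩, rfl⟩
  map_target' := by
    intro q hq
    obtain ⟨h1, h2, -⟩ := c.inv_of_mem_target hq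
    simpa [h1] using h2
  left_inv' := by
    rintro ⟨_, y, hy, rfl⟩ hp
    have h := c.inv_lin y hy hp
    have h' : c.inv (c.lin (j y)) ∈ j '' U := by rw [h]; exact ⟨y, hy, rfl⟩
    rw [dif_pos h']
    exact Subtype.ext h
  right_inv' := by
    intro q hq
    obtain ⟨h1, -, h2, -⟩ := c.inv_of_mem_target hq
    rw [dif_pos h1]
    exact h2
  open_source := c.isOpen_dom.preimage continuous_subtype_val
  open_target := c.isOpen_target hj
  continuousOn_toFun := (c.lin.continuous.comp continuous_subtype_val).continuousOn
  continuousOn_invFun := by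
    rw [IsInducing.subtypeVal.continuousOn_iff]
    refine ContinuousOn.congr (f := c.inv)
      (fun q hq => (c.inv_of_mem_target hq).2.2.2.continuousAt.continuousWithinAt) fun q hq => ?_
    simp only [Function.comp_apply]
    rw [dif_pos (c.inv_of_mem_target hq).1]

theorem toChart_symm_coe (c : ImageChart j U d x) (hj : ContDiff ℝ ∞ j) (hx : x ∈ U)
    {q : EuclideanSpace ℝ (Fin d)} (hq : q ∈ c.target) :
    ((c.toChart hj hx).symm q : W) = c.inv q := by
  classical
  change Subtype.val (dite _ _ _) = _
  rw [dif_pos (c.inv_of_mem_target hq).1]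

end ImageChart

/-- An image covered by charts that are restrictions of linear maps is a manifold onto which `j` is
a submersion, and the kernels of its tangent maps are those of `j`. -/
theorem exists_manifold_image {j : V → W} {U : Opens V} {d : ℕ} (hj : ContDiff ℝ ∞ j)
    (c : ∀ x ∈ U, ImageChart j U d x) :
    ∃ (_ : ChartedSpace (EuclideanSpace ℝ (Fin d)) (j '' (U : Set V)))
      (_ : IsManifold 𝓘(ℝ, EuclideanSpace ℝ (Fin d)) ∞ (j '' (U : Set V))),
      IsSurjectiveSubmersion (U := U) (P := j '' (U : Set V)) d
        (fun x => ⟨j x, Set.mem_image_of_mem j x.2⟩) ∧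
      ∀ x : U, kerTangent (U := U) (P := j '' (U : Set V)) d
        (fun x => ⟨j x, Set.mem_image_of_mem j x.2⟩) x
          = LinearMap.ker (fderiv ℝ j x).toLinearMap := by
  -- The chart at `p` is the one attached to a chosen preimage of `p`, which may be a different
  -- point of the fibre from the one considered later.
  choose pre hpre hjpre using fun p : j '' (U : Set V) => p.2
  let e (p : j '' (U : Set V)) := (c (pre p) (hpre p)).toChart hj (hpre p)
  let cs : ChartedSpace (EuclideanSpace ℝ (Fin d)) (j '' (U : Set V)) :=
    { atlas := Set.range e
      chartAt := e
      mem_chart_source := fun p => by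
        change (p : W) ∈ (c (pre p) (hpre p)).dom
        rw [← hjpre p]
        exact (c (pre p) (hpre p)).mem_dom
      chart_mem_atlas := fun p => ⟨p, rfl⟩ }
  have hman : IsManifold 𝓘(ℝ, EuclideanSpace ℝ (Fin d)) ∞ (j '' (U : Set V)) := by
    refine isManifold_of_contDiffOn _ _ _ ?_
    rintro _ _ ⟨p, rfl⟩ ⟨p', rfl⟩
    simp only [modelWithCornersSelf_coe, modelWithCornersSelf_coe_symm, Set.range_id,
      Set.inter_univ, Set.preimage_id, Function.comp_id, Function.id_comp]
    intro q hq
    have hq1 : q ∈ (c (pre p) (hpre p)).target := hq.1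
    have h1 := ((c (pre p) (hpre p)).inv_of_mem_target hq1).2.2.2
    -- On the overlap the transition map is `lin'` ∘ `inv`, a composition of maps between vector
    -- spaces.
    have h2 := ((c (pre p') (hpre p')).lin.contDiff.contDiffAt.comp q h1).contDiffWithinAt
      (s := ((e p).symm ≫ₕ e p').source)
    refine h2.congr (fun r hr => ?_) ?_
    · exact congrArg (c (pre p') (hpre p')).lin
        ((c (pre p) (hpre p)).toChart_symm_coe hj (hpre p) hr.1)
    · exact congrArg (c (pre p') (hpre p')).lin
        ((c (pre p) (hpre p)).toChart_symm_coe hj (hpre p) hq1)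
  let J : U → j '' (U : Set V) := fun x => ⟨j x, Set.mem_image_of_mem j x.2⟩
  let l (x : U) := (c (pre (J x)) (hpre (J x))).lin
  have hchart (x y : U) : chartAt (EuclideanSpace ℝ (Fin d)) (J x) (J y) = l x (j y) := rfl
  have hdom (x : U) : j x ∈ (c (pre (J x)) (hpre (J x))).dom := by
    have := (c (pre (J x)) (hpre (J x))).mem_dom
    rwa [hjpre (J x)] at this
  have hJ : ContMDiff 𝓘(ℝ, V) 𝓘(ℝ, EuclideanSpace ℝ (Fin d)) ∞ J := by
    intro x
    rw [contMDiffAt_iff_target]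
    refine ⟨((hj.continuous.comp continuous_subtype_val).subtype_mk _).continuousAt, ?_⟩
    exact (contMDiffAt_coe_iff (fun y => l x (j y)) x).2
      ((l x).contDiff.comp hj).contDiffAt
  have hmf (x : U) : (mfderiv 𝓘(ℝ, V) 𝓘(ℝ, EuclideanSpace ℝ (Fin d)) J x :
      V →L[ℝ] EuclideanSpace ℝ (Fin d)) = l x ∘L fderiv ℝ j x := by
    rw [mfderiv_eq_fderiv ((hJ x).mdifferentiableAt (by simp)) (fun y => l x (j y)) (hchart x)]
    exact ((l x).hasFDerivAt.comp (x : V) (hj.differentiable (by simp) x).hasFDerivAt).fderiv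
  refine ⟨cs, hman, ⟨?_, hJ, fun x => ?_⟩, fun x => ?_⟩
  · rintro ⟨_, y, hy, rfl⟩
    exact ⟨⟨y, hy⟩, rfl⟩
  · have h := (c (pre (J x)) (hpre (J x))).surjective x x.2 (hdom x)
    have h2 := hmf x
    change Function.Surjective (mfderiv 𝓘(ℝ, V) 𝓘(ℝ, EuclideanSpace ℝ (Fin d)) J x :
      V →L[ℝ] EuclideanSpace ℝ (Fin d))
    rw [h2]
    exact h
  · let C := c (pre (J x)) (hpre (J x))
    change LinearMap.ker (mfderiv 𝓘(ℝ, V) 𝓘(ℝ, EuclideanSpace ℝ (Fin d)) J x :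
      V →L[ℝ] EuclideanSpace ℝ (Fin d)).toLinearMap = _
    rw [hmf x]
    have hd := (hj.differentiable (by simp) (x : V)).hasFDerivAt
    -- Differentiating inv ∘ lin ∘ j = j shows that composing with `lin` does not enlarge the kernel
    -- of the derivative of `j`.
    have hev : C.inv ∘ (C.lin ∘ j) =ᶠ[𝓝 (x : V)] j := by
      filter_upwards [(U.isOpen.inter (C.isOpen_dom.preimage hj.continuous)).mem_nhds
        ⟨x.2, hdom x⟩] with y hy
      exact C.inv_lin y hy.1 hy.2
    have hinv := ((C.contDiffAt_inv x x.2 (hdom x)).differentiableAt (by simp)).hasFDerivAt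
    have hcomp := (hinv.comp (x : V) (C.lin.hasFDerivAt.comp (x : V) hd)).congr_of_eventuallyEq
      hev.symm
    have huniq := hcomp.unique hd
    refine Submodule.ext fun v : V => ?_
    change l x (fderiv ℝ j x v) = 0 ↔ fderiv ℝ j x v = 0
    refine ⟨fun h => ?_, fun h => by rw [h, map_zero]⟩
    exact (DFunLike.congr_fun huniq v).symm.trans ((congrArg _ h).trans (map_zero (fderiv ℝ C.inv (C.lin (j x)))))

end Image

end UnitaryDualPair

namespace UnitaryDualPair

section MatrixCalculus

variable {n m k : ℕ}

/-! ### Calculus of matrix-valued maps -/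

/-- The skew-Hermitian part of a square matrix. -/
def toSkew (k : ℕ) : Matrix (Fin k) (Fin k) ℂ →ₗ[ℝ] Skew k where
  toFun X := ⟨(1 / 2 : ℝ) • (X - Xᴴ), by
    change star ((1 / 2 : ℝ) • (X - Xᴴ)) = -((1 / 2 : ℝ) • (X - Xᴴ))
    rw [star_smul, star_sub, Matrix.star_eq_conjTranspose, Matrix.star_eq_conjTranspose,
      Matrix.conjTranspose_conjTranspose, star_trivial, ← smul_neg, neg_sub]⟩
  map_add' X Y := Subtype.ext (by
    simp only [Matrix.conjTranspose_add, Submodule.coe_add]; module)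
  map_smul' r X := Subtype.ext (by
    simp only [Matrix.conjTranspose_smul, star_trivial, Submodule.coe_smul, RingHom.id_apply]
    module)

theorem toSkew_coe (X : Matrix (Fin k) (Fin k) ℂ) :
    (toSkew k X : Matrix (Fin k) (Fin k) ℂ) = (1 / 2 : ℝ) • (X - Xᴴ) := rfl

theorem Skew.conjTranspose_coe (s : Skew k) :
    (s : Matrix (Fin k) (Fin k) ℂ)ᴴ = -(s : Matrix (Fin k) (Fin k) ℂ) := s.2

theorem toSkew_of_skew (s : Skew k) : toSkew k s = s := by
  apply Subtype.ext
  rw [toSkew_coe, s.conjTranspose_coe]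
  module

theorem toSkew_eq_zero_iff (X : Matrix (Fin k) (Fin k) ℂ) : toSkew k X = 0 ↔ Xᴴ = X := by
  rw [← Subtype.coe_inj, toSkew_coe, Submodule.coe_zero, smul_eq_zero_iff_right (by norm_num),
    sub_eq_zero, eq_comm]

theorem toSkew_surjective : Function.Surjective (toSkew k) := fun s => ⟨s, toSkew_of_skew s⟩

/-- Conjugate transposition as a continuous real-linear map. -/
def conjL (n m : ℕ) : Matrix (Fin n) (Fin m) ℂ →L[ℝ] Matrix (Fin m) (Fin n) ℂ :=
  LinearMap.toContinuousLinearMap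
    { toFun := Matrix.conjTranspose
      map_add' := Matrix.conjTranspose_add
      map_smul' := fun r X => by simp }

theorem conjL_apply (E : Matrix (Fin n) (Fin m) ℂ) : conjL n m E = Eᴴ := rfl

variable {V : Type*} [NormedAddCommGroup V] [NormedSpace ℝ V]

theorem contDiffAt_bilin {A B C : Type*} [NormedAddCommGroup A] [NormedSpace ℝ A]
    [FiniteDimensional ℝ A] [NormedAddCommGroup B] [NormedSpace ℝ B] [FiniteDimensional ℝ B]
    [NormedAddCommGroup C] [NormedSpace ℝ C] (b : A →ₗ[ℝ] B →ₗ[ℝ] C) {f : V → A} {g : V → B}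
    {x : V} {r : ℕ∞ω} (hf : ContDiffAt ℝ r f x) (hg : ContDiffAt ℝ r g x) :
    ContDiffAt ℝ r (fun y => b (f y) (g y)) x :=
  (b.toContinuousBilinearMap.contDiff.contDiffAt.comp x hf).clm_apply hg

theorem fderiv_bilin_diag {A C : Type*} [NormedAddCommGroup A] [NormedSpace ℝ A]
    [FiniteDimensional ℝ A] [NormedAddCommGroup C] [NormedSpace ℝ C] (b : A →ₗ[ℝ] A →ₗ[ℝ] C)
    (x v : A) : fderiv ℝ (fun y => b y y) x v = b x v + b v x := by
  have h := b.toContinuousBilinearMap.hasFDerivAt (x := x) |>.clm_apply (hasFDerivAt_id x)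
  exact DFunLike.congr_fun (HasFDerivAt.fderiv (f := fun y => b y y) h) v

theorem contDiffAt_matrix_mul {f : V → Matrix (Fin n) (Fin m) ℂ}
    {g : V → Matrix (Fin m) (Fin k) ℂ} {x : V} {r : ℕ∞ω} (hf : ContDiffAt ℝ r f x)
    (hg : ContDiffAt ℝ r g x) : ContDiffAt ℝ r (fun y => f y * g y) x :=
  contDiffAt_bilin (LinearMap.mk₂ ℝ (fun A B => A * B) Matrix.add_mul
    (fun _ _ _ => Matrix.smul_mul _ _ _) Matrix.mul_add (fun _ _ _ => Matrix.mul_smul _ _ _)) hf hg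

theorem contDiff_det {r : ℕ∞ω} : ContDiff ℝ r (Matrix.det : Matrix (Fin k) (Fin k) ℂ → ℂ) := by
  have h (i j : Fin k) : ContDiff ℝ r (fun A : Matrix (Fin k) (Fin k) ℂ => A i j) :=
    (LinearMap.toContinuousLinearMap (Matrix.entryLinearMap ℝ ℂ i j)).contDiff
  have : (Matrix.det : Matrix (Fin k) (Fin k) ℂ → ℂ) =
      fun A => ∑ σ : Equiv.Perm (Fin k), ((σ.sign : ℤ) : ℂ) * ∏ i, A (σ i) i :=
    funext Matrix.det_apply'
  rw [this]
  exact ContDiff.sum fun σ _ => contDiff_const.mul (contDiff_prod fun i _ => h _ _)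

/-- Each entry of the adjugate is a determinant with one row replaced by a unit vector. Together
with the smoothness of `det`, this gives smoothness of inversion by Cramer's rule. -/
theorem contDiff_adjugate {r : ℕ∞ω} :
    ContDiff ℝ r (Matrix.adjugate : Matrix (Fin k) (Fin k) ℂ → Matrix (Fin k) (Fin k) ℂ) := by
  have : (Matrix.adjugate : Matrix (Fin k) (Fin k) ℂ → Matrix (Fin k) (Fin k) ℂ) =
      fun A => ∑ i, ∑ j, LinearMap.toContinuousLinearMap
        (Matrix.singleLinearMap ℝ i j : ℂ →ₗ[ℝ] Matrix (Fin k) (Fin k) ℂ)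
        ((A.updateRow j (Pi.single i 1)).det) := by
    funext A
    conv_lhs => rw [Matrix.matrix_eq_sum_single A.adjugate]
    simp only [Matrix.adjugate_apply]
    rfl
  rw [this]
  refine ContDiff.sum fun i _ => ContDiff.sum fun j _ => ContinuousLinearMap.contDiff _ |>.comp ?_
  refine contDiff_det.comp ?_
  -- Replacing a row is an affine operation: zeroing the row is linear, and the new row is a
  -- constant.
  have h2 (A : Matrix (Fin k) (Fin k) ℂ) : A.updateRow j (Pi.single i 1) =
      A.updateRow j 0 + (0 : Matrix (Fin k) (Fin k) ℂ).updateRow j (Pi.single i 1) := by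
    ext a b
    by_cases h : a = j
    · subst h; simp
    · simp [h]
  rw [funext h2]
  refine ContDiff.add ?_ contDiff_const
  let l : Matrix (Fin k) (Fin k) ℂ →ₗ[ℝ] Matrix (Fin k) (Fin k) ℂ :=
    { toFun := fun A => A.updateRow j 0
      map_add' := fun A B => by
        ext a b
        by_cases h : a = j
        · subst h; simp
        · simp [h]
      map_smul' := fun c A => by
        ext a b
        by_cases h : a = j
        · subst h; simp
        · simp [h] }
  exact (LinearMap.toContinuousLinearMap l).contDiff

theorem contDiffAt_matrix_inv {f : V → Matrix (Fin k) (Fin k) ℂ} {x : V} {r : ℕ∞ω}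
    (hf : ContDiffAt ℝ r f x) (hx : (f x).det ≠ 0) : ContDiffAt ℝ r (fun y => (f y)⁻¹) x := by
  have h : (fun y => (f y)⁻¹) = fun y => (f y).det⁻¹ • (f y).adjugate := by
    funext y
    rw [Matrix.inv_def, Ring.inverse_eq_inv']
  rw [h]
  exact ((contDiff_det.contDiffAt.comp x hf).inv hx).smul (contDiff_adjugate.contDiffAt.comp x hf)

/-! ### The tangent maps of the momentum maps -/

/-- The sesquilinear map of which `j_L` is the quadratic map. -/
def jLB (n m : ℕ) :
    Matrix (Fin n) (Fin m) ℂ →ₗ[ℝ] Matrix (Fin n) (Fin m) ℂ →ₗ[ℝ] Skew n :=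
  LinearMap.mk₂ ℝ (fun E F => toSkew n ((Complex.I / 2) • (E * Fᴴ)))
    (by intro A B C; rw [Matrix.add_mul, smul_add, map_add])
    (by intro r A B; rw [Matrix.smul_mul, smul_comm, map_smul])
    (by intro A B C; rw [Matrix.conjTranspose_add, Matrix.mul_add, smul_add, map_add])
    (by intro r A B
        rw [Matrix.conjTranspose_smul, star_trivial, Matrix.mul_smul, smul_comm, map_smul])

theorem jL_eq_jLB : jL n m = fun E => jLB n m E E :=
  funext fun E => (toSkew_of_skew (jL n m E)).symm

theorem jR_eq_jL : jR n m = jL m n ∘ conjL n m := by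
  funext E
  apply Subtype.ext
  simp [jR, jL, conjL_apply]

theorem contDiff_jL {r : ℕ∞ω} : ContDiff ℝ r (jL n m) := by
  rw [jL_eq_jLB]
  exact contDiff_iff_contDiffAt.2 fun E =>
    contDiffAt_bilin (jLB n m) contDiffAt_id contDiffAt_id

theorem contDiff_jR {r : ℕ∞ω} : ContDiff ℝ r (jR n m) := by
  rw [jR_eq_jL]
  exact contDiff_jL.comp (conjL n m).contDiff

theorem fderiv_jL_coe (E v : Matrix (Fin n) (Fin m) ℂ) :
    (fderiv ℝ (jL n m) E v : Matrix (Fin n) (Fin n) ℂ)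
      = (Complex.I / 2) • (v * Eᴴ + E * vᴴ) := by
  have h2 : fderiv ℝ (jL n m) E v = toSkew n ((Complex.I / 2) • (E * vᴴ)) +
      toSkew n ((Complex.I / 2) • (v * Eᴴ)) := by
    rw [jL_eq_jLB]; exact fderiv_bilin_diag (jLB n m) E v
  rw [h2, Submodule.coe_add, toSkew_coe, toSkew_coe]
  have hI : star (Complex.I / 2) = -(Complex.I / 2) := by simp [neg_div]
  simp only [Matrix.conjTranspose_smul, Matrix.conjTranspose_mul,
    Matrix.conjTranspose_conjTranspose, hI]
  module

theorem fderiv_jR_coe (E v : Matrix (Fin n) (Fin m) ℂ) :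
    (fderiv ℝ (jR n m) E v : Matrix (Fin m) (Fin m) ℂ)
      = (Complex.I / 2) • (vᴴ * E + Eᴴ * v) := by
  have h := (contDiff_jL (n := m) (m := n) (r := 1)).differentiable (by simp) (conjL n m E)
    |>.hasFDerivAt.comp E (conjL n m).hasFDerivAt
  rw [jR_eq_jL]
  refine (congrArg Subtype.val (DFunLike.congr_fun h.fderiv v)).trans ?_
  change (fderiv ℝ (jL m n) Eᴴ vᴴ : Matrix (Fin m) (Fin m) ℂ) = _
  rw [fderiv_jL_coe]
  simp

theorem I_div_two_ne_zero : (Complex.I / 2) ≠ 0 := by simp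

theorem fderiv_jL_eq_zero_iff (E v : Matrix (Fin n) (Fin m) ℂ) :
    fderiv ℝ (jL n m) E v = 0 ↔ v * Eᴴ + E * vᴴ = 0 := by
  rw [← Subtype.coe_inj, fderiv_jL_coe, Submodule.coe_zero,
    smul_eq_zero_iff_right I_div_two_ne_zero]

theorem fderiv_jR_eq_zero_iff (E v : Matrix (Fin n) (Fin m) ℂ) :
    fderiv ℝ (jR n m) E v = 0 ↔ vᴴ * E + Eᴴ * v = 0 := by
  rw [← Subtype.coe_inj, fderiv_jR_coe, Submodule.coe_zero,
    smul_eq_zero_iff_right I_div_two_ne_zero]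

theorem jL_eq_iff (E F : Matrix (Fin n) (Fin m) ℂ) :
    jL n m E = jL n m F ↔ E * Eᴴ = F * Fᴴ := by
  rw [← Subtype.coe_inj]
  exact (smul_right_injective _ I_div_two_ne_zero).eq_iff

theorem jR_eq_iff (E F : Matrix (Fin n) (Fin m) ℂ) :
    jR n m E = jR n m F ↔ Eᴴ * E = Fᴴ * F := by
  rw [← Subtype.coe_inj]
  exact (smul_right_injective _ I_div_two_ne_zero).eq_iff

end MatrixCalculus

end UnitaryDualPair

namespace UnitaryDualPair

open TopologicalSpace

section FullRank

variable {n m k : ℕ}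

/-! ### Matrices of full rank -/

/-- The null vector is kept as a one-column matrix so that products such as AB† and B†B are matrix
products. -/
theorem exists_mul_eq_zero_of_rank_lt {E : Matrix (Fin n) (Fin m) ℂ} (h : E.rank < m) :
    ∃ B : Matrix (Fin m) (Fin 1) ℂ, B ≠ 0 ∧ E * B = 0 := by
  by_contra! hB
  have hinj : Function.Injective E.mulVecLin := by
    rw [← LinearMap.ker_eq_bot, LinearMap.ker_eq_bot']
    intro b hb0
    by_contra hne
    refine hB (Matrix.replicateCol (Fin 1) b) ?_ ?_
    · simpa using hne
    · rw [← Matrix.replicateCol_mulVec, ← Matrix.mulVecLin_apply, hb0, Matrix.replicateCol_zero]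
  have := LinearMap.finrank_range_of_inj hinj
  rw [Module.finrank_fin_fun] at this
  exact h.ne this

open scoped ComplexOrder in
theorem rank_eq_iff_det_ne_zero (E : Matrix (Fin n) (Fin m) ℂ) :
    E.rank = m ↔ (Eᴴ * E).det ≠ 0 := by
  constructor
  · intro h hdet
    obtain ⟨b, hb, h0⟩ := Matrix.exists_mulVec_eq_zero_iff.2 hdet
    rw [Matrix.conjTranspose_mul_self_mulVec_eq_zero] at h0
    have hinj : Function.Injective E.mulVecLin := by
      rw [← LinearMap.ker_eq_bot]
      have h1 := E.mulVecLin.finrank_range_add_finrank_ker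
      rw [Module.finrank_fin_fun] at h1
      have h2 : Module.finrank ℂ (LinearMap.range E.mulVecLin) = m := h
      exact Submodule.finrank_eq_zero.1 (by omega)
    exact hb (hinj (by simpa using h0))
  · intro h
    rw [← Matrix.rank_conjTranspose_mul_self, Matrix.rank_of_det_ne_zero h, Fintype.card_fin]

theorem mem_fullRank_iff (E : Matrix (Fin n) (Fin m) ℂ) :
    E ∈ fullRank n m ↔ IsUnit (Eᴴ * E).det := by
  rw [isUnit_iff_ne_zero, ← rank_eq_iff_det_ne_zero]; rfl

theorem isOpen_fullRank (n m : ℕ) : IsOpen (fullRank n m) := by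
  have h : fullRank n m = (fun E : Matrix (Fin n) (Fin m) ℂ => (Eᴴ * E).det) ⁻¹' {0}ᶜ := by
    ext E
    exact rank_eq_iff_det_ne_zero E
  rw [h]
  refine isOpen_compl_singleton.preimage (ContDiff.continuous (𝕜 := ℝ) (n := 0) ?_)
  exact contDiff_det.comp (contDiff_iff_contDiffAt.2 fun E =>
    contDiffAt_matrix_mul (conjL n m).contDiff.contDiffAt contDiffAt_id)

/-- The open set of matrices of full rank. -/
def fullRankOpens (n m : ℕ) : Opens (Matrix (Fin n) (Fin m) ℂ) :=
  ⟨fullRank n m, isOpen_fullRank n m⟩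

/-! ### The kernels of the tangent maps -/

/-- Multiplying vE† = -Ev† on the right by E(E†E)⁻¹ exhibits v as Es. Substituting back and
sandwiching between E† and E gives (E†E)(s + s†)(E†E) = 0, whence s is skew-Hermitian. -/
theorem eq_mul_skew_of_mul_add_eq_zero {E v : Matrix (Fin n) (Fin m) ℂ} (hE : E ∈ fullRank n m)
    (hv : v * Eᴴ + E * vᴴ = 0) :
    ∃ s : Matrix (Fin m) (Fin m) ℂ, sᴴ = -s ∧ v = E * s := by
  rw [mem_fullRank_iff] at hE
  have h1 : v * Eᴴ = -(E * vᴴ) := eq_neg_of_add_eq_zero_left hv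
  have hvs : v = E * (-(vᴴ * E * (Eᴴ * E)⁻¹)) := by
    calc v = v * (Eᴴ * E) * (Eᴴ * E)⁻¹ := (Matrix.mul_nonsing_inv_cancel_right _ _ hE).symm
      _ = (v * Eᴴ) * E * (Eᴴ * E)⁻¹ := by simp only [Matrix.mul_assoc]
      _ = _ := by rw [h1]; simp only [Matrix.neg_mul, Matrix.mul_neg, Matrix.mul_assoc]
  refine ⟨_, ?_, hvs⟩
  generalize -(vᴴ * E * (Eᴴ * E)⁻¹) = s at hvs
  subst hvs
  have h2 : (Eᴴ * E) * (s + sᴴ) * (Eᴴ * E) = 0 := by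
    have : (Eᴴ * E) * (s + sᴴ) * (Eᴴ * E) = Eᴴ * (E * s * Eᴴ + E * (E * s)ᴴ) * E := by
      rw [Matrix.conjTranspose_mul]
      simp only [Matrix.mul_add, Matrix.add_mul, Matrix.mul_assoc]
    rw [this, hv, Matrix.mul_zero, Matrix.zero_mul]
  generalize Eᴴ * E = A at hE h2
  have h3 : s + sᴴ = A⁻¹ * (A * (s + sᴴ) * A) * A⁻¹ := by
    rw [← Matrix.mul_assoc, ← Matrix.mul_assoc, Matrix.nonsing_inv_mul _ hE, Matrix.one_mul,
      Matrix.mul_nonsing_inv_cancel_right _ _ hE]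
  rw [h2, Matrix.mul_zero, Matrix.zero_mul] at h3
  exact eq_neg_of_add_eq_zero_right h3

open scoped ComplexOrder in
-- With X = E†w, lying in the kernel for `jR` means X + X† = 0. Testing orthogonality on E · i(X† +
-- X) gives -Re Tr((X† + X)X) = -½‖X + X†‖² in the Frobenius norm. Conversely, Tr(s†X) is real when
-- s and X are both skew-Hermitian.
theorem orthogonal_ker_fderiv_jL {E : Matrix (Fin n) (Fin m) ℂ} (hE : E ∈ fullRank n m) :
    (Ω n m).form.orthogonal (LinearMap.ker (fderiv ℝ (jL n m) E).toLinearMap)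
      = LinearMap.ker (fderiv ℝ (jR n m) E).toLinearMap := by
  ext w
  rw [LinearMap.BilinForm.mem_orthogonal_iff]
  simp only [LinearMap.mem_ker, ContinuousLinearMap.coe_coe, fderiv_jL_eq_zero_iff,
    fderiv_jR_eq_zero_iff]
  constructor
  · intro h
    obtain ⟨X, hX⟩ : ∃ X, Eᴴ * w = X := ⟨_, rfl⟩
    have hXs : wᴴ * E = Xᴴ := by simp [← hX]
    rw [hXs, hX]
    have h1 := h (E * (Complex.I • (Xᴴ + X))) (by
      simp only [Matrix.conjTranspose_mul, Matrix.conjTranspose_smul, Matrix.conjTranspose_add,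
        Matrix.conjTranspose_conjTranspose, Complex.star_def, Complex.conj_I, Matrix.mul_smul,
        Matrix.smul_mul, Matrix.mul_assoc]
      rw [add_comm X]
      module)
    change ((E * (Complex.I • (Xᴴ + X)))ᴴ * w).trace.im = 0 at h1
    rw [Matrix.conjTranspose_mul, Matrix.mul_assoc, hX] at h1
    have h2 : ((Xᴴ + X) * X).trace.re = 0 := by
      have h3 : (Complex.I • (Xᴴ + X))ᴴ * X = (-Complex.I) • ((Xᴴ + X) * X) := by
        simp only [Matrix.conjTranspose_smul, Matrix.conjTranspose_add,
          Matrix.conjTranspose_conjTranspose, Complex.star_def, Complex.conj_I, Matrix.smul_mul]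
        rw [add_comm X]
      rw [h3, Matrix.trace_smul] at h1
      simpa using h1
    rw [← Matrix.trace_conjTranspose_mul_self_eq_zero_iff]
    have h4 : (Xᴴ + X)ᴴ * (Xᴴ + X) = (Xᴴ + X) * X + (Xᴴ + X) * Xᴴ := by
      simp only [Matrix.conjTranspose_add, Matrix.conjTranspose_conjTranspose]
      rw [add_comm X, Matrix.mul_add, add_comm]
    have h5 : ((Xᴴ + X) * Xᴴ).trace = star ((Xᴴ + X) * X).trace := by
      rw [← Matrix.trace_conjTranspose, Matrix.conjTranspose_mul, Matrix.conjTranspose_add,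
        Matrix.conjTranspose_conjTranspose, add_comm X, Matrix.trace_mul_comm]
    rw [h4, Matrix.trace_add, h5]
    apply Complex.ext
    · simp [h2]
    · simp
  · intro hw v hv
    obtain ⟨s, hs, rfl⟩ := eq_mul_skew_of_mul_add_eq_zero hE hv
    change ((E * s)ᴴ * w).trace.im = 0
    have hX : (Eᴴ * w)ᴴ = -(Eᴴ * w) := by
      rw [Matrix.conjTranspose_mul, Matrix.conjTranspose_conjTranspose]
      exact eq_neg_of_add_eq_zero_left hw
    rw [Matrix.conjTranspose_mul, Matrix.mul_assoc]
    have h1 : star (sᴴ * (Eᴴ * w)).trace = (sᴴ * (Eᴴ * w)).trace := by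
      rw [← Matrix.trace_conjTranspose, Matrix.conjTranspose_mul, hX,
        Matrix.conjTranspose_conjTranspose, hs, Matrix.trace_mul_comm, Matrix.mul_neg,
        Matrix.neg_mul]
    have h2 := congrArg Complex.im h1
    simp only [Complex.star_def, Complex.conj_im] at h2
    linarith

/-! ### The rank of the tangent map of `j_R` -/

theorem fderiv_jR_surjective {E : Matrix (Fin n) (Fin m) ℂ} (hE : E ∈ fullRank n m) :
    Function.Surjective (fderiv ℝ (jR n m) E) := by
  rw [mem_fullRank_iff] at hE
  intro s
  -- Chosen so that E†v = -is, which is Hermitian; both summands of the derivative then agree, and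
  -- (i/2)(-2is) = s.
  refine ⟨E * ((Eᴴ * E)⁻¹ * ((-Complex.I) • (s : Matrix (Fin m) (Fin m) ℂ))), Subtype.ext ?_⟩
  rw [fderiv_jR_coe]
  have h1 : Eᴴ * (E * ((Eᴴ * E)⁻¹ * ((-Complex.I) • (s : Matrix (Fin m) (Fin m) ℂ)))) =
      (-Complex.I) • (s : Matrix (Fin m) (Fin m) ℂ) := by
    rw [← Matrix.mul_assoc, Matrix.mul_nonsing_inv_cancel_left _ _ hE]
  have h2 (v : Matrix (Fin n) (Fin m) ℂ) : vᴴ * E = (Eᴴ * v)ᴴ := by simp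
  rw [h2, h1, Matrix.conjTranspose_smul, s.conjTranspose_coe, star_neg, Complex.star_def,
    Complex.conj_I, neg_neg, smul_neg, ← neg_smul, ← add_smul, smul_smul]
  have : Complex.I / 2 * (-Complex.I + -Complex.I) = 1 := by
    ring_nf; simp
  rw [this, one_smul]

/-- Multiplication by i identifies Hermitian with skew-Hermitian matrices, so each is half of the
2k² real dimensions. -/
theorem finrank_skew (k : ℕ) : Module.finrank ℝ (Skew k) = k ^ 2 := by
  have h1 := (toSkew k).finrank_range_add_finrank_ker
  rw [LinearMap.range_eq_top.2 toSkew_surjective, finrank_top, Module.finrank_matrix] at h1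
  let e : LinearMap.ker (toSkew k) ≃ₗ[ℝ] Skew k :=
    { toFun := fun X => ⟨Complex.I • (X : Matrix (Fin k) (Fin k) ℂ), by
        have hX : (X : Matrix (Fin k) (Fin k) ℂ)ᴴ = X := (toSkew_eq_zero_iff _).1 X.2
        change star (Complex.I • (X : Matrix (Fin k) (Fin k) ℂ)) = -(Complex.I • _)
        rw [Matrix.star_eq_conjTranspose, Matrix.conjTranspose_smul, hX]
        simp⟩
      invFun := fun s => ⟨(-Complex.I) • (s : Matrix (Fin k) (Fin k) ℂ), by
        rw [LinearMap.mem_ker, toSkew_eq_zero_iff, Matrix.conjTranspose_smul, s.conjTranspose_coe]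
        simp⟩
      map_add' := fun X Y => Subtype.ext (smul_add _ _ _)
      map_smul' := fun r X => Subtype.ext (smul_comm _ _ _)
      left_inv := fun X => Subtype.ext (by simp [smul_smul])
      right_inv := fun s => Subtype.ext (by simp [smul_smul]) }
  rw [e.finrank_eq, Complex.finrank_real_complex, Fintype.card_fin] at h1
  nlinarith

theorem rankTjR_of_mem_fullRank {E : Matrix (Fin n) (Fin m) ℂ} (hE : E ∈ fullRank n m) :
    rankTjR n m E = m ^ 2 := by
  rw [rankTjR, LinearMap.range_eq_top.2 (fderiv_jR_surjective hE), finrank_top, finrank_skew]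

open scoped ComplexOrder in
-- If EB = 0, then B†(v†E + E†v)B = 0 for every v. Thus (i/2)BB† is not in the range, since
-- sandwiching BB† gives (B†B)², nonzero for B ≠ 0.
theorem rankTjR_lt_of_rank_lt {E : Matrix (Fin n) (Fin m) ℂ} (hE : E.rank < m) :
    rankTjR n m E < m ^ 2 := by
  rw [rankTjR, ← finrank_skew m]
  refine Submodule.finrank_lt fun htop => ?_
  obtain ⟨B, hB, hEB⟩ := exists_mul_eq_zero_of_rank_lt hE
  obtain ⟨v, hv⟩ := LinearMap.range_eq_top.1 htop (jR 1 m Bᴴ)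
  have h1 : (Complex.I / 2) • (vᴴ * E + Eᴴ * v) = (Complex.I / 2) • (Bᴴᴴ * Bᴴ) := by
    rw [← fderiv_jR_coe]
    exact congrArg Subtype.val hv
  have h2 := smul_right_injective _ I_div_two_ne_zero h1
  rw [Matrix.conjTranspose_conjTranspose] at h2
  have h3 : (Bᴴ * B)ᴴ * (Bᴴ * B) = 0 := by
    calc (Bᴴ * B)ᴴ * (Bᴴ * B) = Bᴴ * (B * Bᴴ) * B := by
          simp only [Matrix.conjTranspose_mul, Matrix.conjTranspose_conjTranspose, Matrix.mul_assoc]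
      _ = Bᴴ * vᴴ * (E * B) + (E * B)ᴴ * v * B := by
          rw [← h2, Matrix.conjTranspose_mul]
          simp only [Matrix.mul_add, Matrix.add_mul, Matrix.mul_assoc]
      _ = 0 := by simp [hEB]
  rw [Matrix.conjTranspose_mul_self_eq_zero, Matrix.conjTranspose_mul_self_eq_zero] at h3
  exact hB h3

end FullRank

end UnitaryDualPair

namespace UnitaryDualPair

open TopologicalSpace

section Charts

variable {n m k : ℕ}

/-! ### Charts of the images of the momentum maps -/

/-- The global chart of the image of `j_R`, which is open in `𝔲(m)`. -/
def jRChart (n m : ℕ) (x : Matrix (Fin n) (Fin m) ℂ) :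
    ImageChart (jR n m) (fullRankOpens n m) (Module.finrank ℝ (Skew m)) x :=
  let e : Skew m ≃L[ℝ] EuclideanSpace ℝ (Fin (Module.finrank ℝ (Skew m))) :=
    ContinuousLinearEquiv.ofFinrankEq (by simp)
  { lin := LinearMap.toContinuousLinearMap e.toLinearEquiv.toLinearMap
    dom := Set.univ
    inv := e.symm
    isOpen_dom := isOpen_univ
    mem_dom := Set.mem_univ _
    inv_lin := fun y _ _ => e.symm_apply_apply _
    contDiffAt_inv := fun y _ _ => e.symm.contDiff.contDiffAt
    surjective := fun _ hy _ => e.surjective.comp (fderiv_jR_surjective hy) }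

/-- The map `C ↦ (T† C - C† T) / 2`. -/
def skewPairing (T : Matrix (Fin n) (Fin m) ℂ) : Matrix (Fin n) (Fin m) ℂ →ₗ[ℝ] Skew m where
  toFun C := toSkew m (Tᴴ * C)
  map_add' A B := by rw [Matrix.mul_add, map_add]
  map_smul' r A := by rw [Matrix.mul_smul, map_smul]; rfl

theorem mem_ker_skewPairing {T C : Matrix (Fin n) (Fin m) ℂ} :
    C ∈ LinearMap.ker (skewPairing T) ↔ Cᴴ * T = Tᴴ * C := by
  rw [LinearMap.mem_ker]
  change toSkew m (Tᴴ * C) = 0 ↔ _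
  rw [toSkew_eq_zero_iff, Matrix.conjTranspose_mul, Matrix.conjTranspose_conjTranspose]

theorem skewPairing_surjective {T : Matrix (Fin n) (Fin m) ℂ} (hT : T ∈ fullRank n m) :
    Function.Surjective (skewPairing T) := by
  rw [mem_fullRank_iff] at hT
  intro s
  refine ⟨T * ((Tᴴ * T)⁻¹ * (s : Matrix (Fin m) (Fin m) ℂ)), ?_⟩
  change toSkew m (Tᴴ * (T * ((Tᴴ * T)⁻¹ * (s : Matrix (Fin m) (Fin m) ℂ)))) = s
  rw [← Matrix.mul_assoc, Matrix.mul_nonsing_inv_cancel_left _ _ hT, toSkew_of_skew]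

theorem finrank_ker_skewPairing {T : Matrix (Fin n) (Fin m) ℂ} (hT : T ∈ fullRank n m) :
    Module.finrank ℝ (LinearMap.ker (skewPairing T)) =
      Module.finrank ℝ (Matrix (Fin n) (Fin m) ℂ) - Module.finrank ℝ (Skew m) := by
  have h := (skewPairing T).finrank_range_add_finrank_ker
  rw [LinearMap.range_eq_top.2 (skewPairing_surjective hT), finrank_top] at h
  omega

/-- The map `w ↦ i w T` from `𝔲(n)` to the space of all `C` for which `T† C` is Hermitian. -/
def mulRight (T : Matrix (Fin n) (Fin m) ℂ) : Skew n →ₗ[ℝ] LinearMap.ker (skewPairing T) where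
  toFun w := ⟨Complex.I • ((w : Matrix (Fin n) (Fin n) ℂ) * T), by
    rw [mem_ker_skewPairing, Matrix.conjTranspose_smul, Matrix.conjTranspose_mul,
      w.conjTranspose_coe]
    simp [Matrix.mul_assoc]⟩
  map_add' w w' := Subtype.ext (by simp [Matrix.add_mul])
  map_smul' r w := Subtype.ext (by
    simp only [Submodule.coe_smul, Matrix.smul_mul, RingHom.id_apply]
    rw [smul_comm])

/-- The inverse of `w ↦ i w T` on matrices `w` of rank `m` with `T† w T` invertible. -/
def mulRightInv (T C : Matrix (Fin n) (Fin m) ℂ) : Skew n :=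
  toSkew n ((-Complex.I) • (C * (Tᴴ * C)⁻¹ * Cᴴ))

theorem contDiffAt_mulRightInv {T C : Matrix (Fin n) (Fin m) ℂ} (h : (Tᴴ * C).det ≠ 0) :
    ContDiffAt ℝ ∞ (mulRightInv T) C := by
  have h1 : ContDiffAt ℝ ∞ (fun C : Matrix (Fin n) (Fin m) ℂ => C * (Tᴴ * C)⁻¹ * Cᴴ) C :=
    contDiffAt_matrix_mul (contDiffAt_matrix_mul contDiffAt_id
      (contDiffAt_matrix_inv (contDiffAt_matrix_mul contDiffAt_const contDiffAt_id) h))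
      (conjL n m).contDiff.contDiffAt
  let l : Matrix (Fin n) (Fin n) ℂ →ₗ[ℝ] Skew n :=
    toSkew n ∘ₗ LinearMap.lsmul ℂ (Matrix (Fin n) (Fin n) ℂ) (-Complex.I) |>.restrictScalars ℝ
  exact (LinearMap.toContinuousLinearMap l).contDiff.contDiffAt.comp C h1

variable {T y : Matrix (Fin n) (Fin m) ℂ}

theorem mulRight_jL_coe :
    (mulRight T (jL n m y) : Matrix (Fin n) (Fin m) ℂ) = (-(1 / 2) : ℂ) • (y * (yᴴ * T)) := by
  change Complex.I • (((Complex.I / 2) • (y * yᴴ)) * T) = _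
  rw [Matrix.smul_mul, smul_smul, Matrix.mul_assoc]
  congr 1
  rw [← mul_div_assoc, Complex.I_mul_I, neg_div]

theorem det_conjTranspose_mul_jL_mul_ne_zero_iff :
    (Tᴴ * (jL n m y : Matrix (Fin n) (Fin n) ℂ) * T).det ≠ 0 ↔ IsUnit (yᴴ * T).det := by
  have : Tᴴ * (jL n m y : Matrix (Fin n) (Fin n) ℂ) * T =
      (Complex.I / 2) • ((yᴴ * T)ᴴ * (yᴴ * T)) := by
    change Tᴴ * ((Complex.I / 2) • (y * yᴴ)) * T = _
    simp [Matrix.mul_assoc]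
  rw [this, Matrix.det_smul, Matrix.det_mul, Matrix.det_conjTranspose, isUnit_iff_ne_zero]
  simp

theorem conjTranspose_mul_mulRight_jL :
    Tᴴ * (mulRight T (jL n m y) : Matrix (Fin n) (Fin m) ℂ) =
      (-(1 / 2) : ℂ) • ((yᴴ * T)ᴴ * (yᴴ * T)) := by
  rw [mulRight_jL_coe]
  simp [Matrix.mul_assoc]

theorem det_conjTranspose_mul_mulRight_jL (h : IsUnit (yᴴ * T).det) :
    (Tᴴ * (mulRight T (jL n m y) : Matrix (Fin n) (Fin m) ℂ)).det ≠ 0 := by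
  rw [isUnit_iff_ne_zero] at h
  rw [conjTranspose_mul_mulRight_jL, Matrix.det_smul, Matrix.det_mul, Matrix.det_conjTranspose]
  simp [h]

/-- A Hermitian h of rank m with T†hT invertible satisfies h = hT(T†hT)⁻¹T†h, so hT determines h.
Here h = iw = -½yy†, and with K = y†T one has C = hT = -½yK and T†C = -½K†K. -/
theorem mulRightInv_mulRight_jL (h : IsUnit (yᴴ * T).det) :
    mulRightInv T (mulRight T (jL n m y) : Matrix (Fin n) (Fin m) ℂ) = jL n m y := by
  rw [mulRightInv, conjTranspose_mul_mulRight_jL, mulRight_jL_coe]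
  generalize yᴴ * T = K at h
  have hK : IsUnit Kᴴ.det := by
    rw [Matrix.det_conjTranspose]; exact h.star
  have h2 : ((-(1 / 2) : ℂ) • (Kᴴ * K))⁻¹ = (-2 : ℂ) • (K⁻¹ * Kᴴ⁻¹) := by
    apply Matrix.inv_eq_right_inv
    rw [Matrix.smul_mul, Matrix.mul_smul, smul_smul, Matrix.mul_assoc,
      Matrix.mul_nonsing_inv_cancel_left _ _ h, Matrix.mul_nonsing_inv _ hK]
    norm_num
  rw [← toSkew_of_skew (jL n m y)]
  congr 1
  rw [h2, Matrix.conjTranspose_smul, Matrix.conjTranspose_mul]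
  change _ = (Complex.I / 2) • (y * yᴴ)
  simp only [Matrix.smul_mul, Matrix.mul_smul, smul_smul]
  have h3 : y * K * (K⁻¹ * Kᴴ⁻¹) * (Kᴴ * yᴴ) = y * yᴴ := by
    rw [Matrix.mul_assoc y, Matrix.mul_nonsing_inv_cancel_left _ _ h, Matrix.mul_assoc y,
      Matrix.nonsing_inv_mul_cancel_left _ _ hK]
  rw [h3]
  congr 1
  simp
  ring

theorem mulRight_fderiv_jL_surjective (h : IsUnit (yᴴ * T).det) :
    Function.Surjective fun v => mulRight T (fderiv ℝ (jL n m) y v) := by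
  rintro ⟨q, hq⟩
  rw [mem_ker_skewPairing] at hq
  obtain ⟨K, hK⟩ : ∃ K, yᴴ * T = K := ⟨_, rfl⟩
  rw [hK] at h
  have hKs : IsUnit Kᴴ.det := by
    rw [Matrix.det_conjTranspose]; exact h.star
  -- The equation to solve is vK + y(v†T) = -2q. The ansatz v = -2qK⁻¹ + yR with R Hermitian reduces
  -- it to RK = K†⁻¹(q†T), and R is Hermitian because q†T is.
  let R : Matrix (Fin m) (Fin m) ℂ := Kᴴ⁻¹ * (qᴴ * T) * K⁻¹
  have hR : Rᴴ = R := by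
    simp only [R, Matrix.conjTranspose_mul, Matrix.conjTranspose_nonsing_inv,
      Matrix.conjTranspose_conjTranspose, Matrix.mul_assoc, hq]
  let v : Matrix (Fin n) (Fin m) ℂ := (-2 : ℂ) • (q * K⁻¹) + y * R
  refine ⟨v, Subtype.ext ?_⟩
  change Complex.I • ((fderiv ℝ (jL n m) y v : Matrix (Fin n) (Fin n) ℂ) * T) = q
  have h1 : v * K = (-2 : ℂ) • q + y * (Kᴴ⁻¹ * (qᴴ * T)) := by
    simp only [v, R, Matrix.add_mul, Matrix.smul_mul, Matrix.mul_assoc,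
      Matrix.nonsing_inv_mul _ h, Matrix.mul_one]
  have h2 : vᴴ * T = -(Kᴴ⁻¹ * (qᴴ * T)) := by
    have : vᴴ = (-2 : ℂ) • (Kᴴ⁻¹ * qᴴ) + R * yᴴ := by
      simp only [v, Matrix.conjTranspose_add, Matrix.conjTranspose_smul, Matrix.conjTranspose_mul,
        Matrix.conjTranspose_nonsing_inv, hR]
      simp
    rw [this, Matrix.add_mul, Matrix.mul_assoc R, hK]
    simp only [R, Matrix.smul_mul, Matrix.mul_assoc, Matrix.nonsing_inv_mul _ h, Matrix.mul_one]
    module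
  rw [fderiv_jL_coe, Matrix.smul_mul, Matrix.add_mul, Matrix.mul_assoc, hK, Matrix.mul_assoc, h1,
    h2, Matrix.mul_neg, add_neg_cancel_right, smul_smul, smul_smul]
  have : Complex.I * (Complex.I / 2) * -2 = 1 := by
    ring_nf; simp
  rw [this, one_smul]

/-- The chart of the image of `j_L` near `j_L T`. -/
def jLChart (T : Matrix (Fin n) (Fin m) ℂ) (hT : T ∈ fullRank n m) :
    ImageChart (jL n m) (fullRankOpens n m)
      (Module.finrank ℝ (Matrix (Fin n) (Fin m) ℂ) - Module.finrank ℝ (Skew m)) T :=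
  let e : LinearMap.ker (skewPairing T) ≃L[ℝ] EuclideanSpace ℝ
      (Fin (Module.finrank ℝ (Matrix (Fin n) (Fin m) ℂ) - Module.finrank ℝ (Skew m))) :=
    ContinuousLinearEquiv.ofFinrankEq (by rw [finrank_ker_skewPairing hT]; simp)
  { lin := LinearMap.toContinuousLinearMap (e.toLinearEquiv.toLinearMap ∘ₗ mulRight T)
    dom := {w | (Tᴴ * (w : Matrix (Fin n) (Fin n) ℂ) * T).det ≠ 0}
    inv := fun q => mulRightInv T (e.symm q : Matrix (Fin n) (Fin m) ℂ)
    isOpen_dom := by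
      exact isOpen_compl_singleton.preimage ((continuous_const.matrix_mul
        continuous_subtype_val).matrix_mul continuous_const).matrix_det
    mem_dom := det_conjTranspose_mul_jL_mul_ne_zero_iff.2 ((mem_fullRank_iff T).1 hT)
    inv_lin := fun y _ hy => by
      have h := det_conjTranspose_mul_jL_mul_ne_zero_iff.1 hy
      change mulRightInv T (e.symm (e (mulRight T (jL n m y))) : Matrix (Fin n) (Fin m) ℂ) = _
      rw [e.symm_apply_apply, mulRightInv_mulRight_jL h]
    contDiffAt_inv := fun y _ hy => by
      have h := det_conjTranspose_mul_jL_mul_ne_zero_iff.1 hy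
      have h2 : ContDiffAt ℝ ∞ (mulRightInv T)
          (e.symm (e (mulRight T (jL n m y))) : Matrix (Fin n) (Fin m) ℂ) := by
        rw [e.symm_apply_apply]
        exact contDiffAt_mulRightInv (det_conjTranspose_mul_mulRight_jL h)
      exact ContDiffAt.comp (g := mulRightInv T) (e (mulRight T (jL n m y))) h2
        (LinearMap.toContinuousLinearMap ((LinearMap.ker (skewPairing T)).subtype ∘ₗ
          e.symm.toLinearEquiv.toLinearMap)).contDiff.contDiffAt
    surjective := fun y _ hy => e.surjective.comp
      (mulRight_fderiv_jL_surjective (det_conjTranspose_mul_jL_mul_ne_zero_iff.1 hy)) }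

end Charts

end UnitaryDualPair

namespace UnitaryDualPair

open TopologicalSpace

section Symmetry

variable {V : Type*} [NormedAddCommGroup V] [NormedSpace ℝ V] [FiniteDimensional ℝ V]
  {W : Type*} [NormedAddCommGroup W] [NormedSpace ℝ W]

/-! ### Momentum maps whose fibres are orbits of symplectic automorphisms -/

/-- `Φ` is a linear symplectic automorphism that preserves `U` and the map `j`. -/
structure IsSymmetry (σ : SymplecticForm V) (j : V → W) (U : Opens V) (Φ : V ≃L[ℝ] V) :
    Prop where
  form : ∀ v w, σ.form (Φ v) (Φ w) = σ.form v w
  mem_iff : ∀ z, Φ z ∈ U ↔ z ∈ U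
  map : ∀ z, j (Φ z) = j z

/-- Transitivity of symplectic symmetries on the fibres makes brackets of pulled-back functions
fibrewise constant, which is what the descent of the bracket requires. -/
theorem exists_poisson_image (σ : SymplecticForm V) {j : V → W} {U : Opens V} {d : ℕ}
    (hj : ContDiff ℝ ∞ j) (c : ∀ x ∈ U, ImageChart j U d x)
    (hsymm : ∀ x ∈ U, ∀ y ∈ U, j x = j y → ∃ Φ, IsSymmetry σ j U Φ ∧ Φ x = y) :
    ∃ (_ : ChartedSpace (EuclideanSpace ℝ (Fin d)) (j '' (U : Set V)))
      (_ : IsManifold 𝓘(ℝ, EuclideanSpace ℝ (Fin d)) ∞ (j '' (U : Set V)))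
      (π : PoissonStructure d (j '' (U : Set V))),
      IsPoissonMap (U := U) σ π (fun x => ⟨j x, Set.mem_image_of_mem j x.2⟩) ∧
      IsSurjectiveSubmersion (U := U) (P := j '' (U : Set V)) d
        (fun x => ⟨j x, Set.mem_image_of_mem j x.2⟩) ∧
      ∀ x : U, kerTangent (U := U) (P := j '' (U : Set V)) d
        (fun x => ⟨j x, Set.mem_image_of_mem j x.2⟩) x
          = LinearMap.ker (fderiv ℝ j x).toLinearMap := by
  obtain ⟨cs, hman, hsub, hker⟩ := exists_manifold_image hj c
  obtain ⟨π, hπ⟩ := exists_poissonStructure σ hsub (by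
    intro f g x y hxy
    obtain ⟨Φ, hΦ, hxy'⟩ := hsymm x x.2 y y.2 (congrArg Subtype.val hxy)
    -- The extension by zero is also invariant off `U`, since Φ preserves the complement.
    have hinv (f : j '' (U : Set V) → ℝ) :
        ext0 (U := U) (f ∘ fun x => ⟨j x, Set.mem_image_of_mem j x.2⟩) ∘ Φ =
          ext0 (f ∘ fun x => ⟨j x, Set.mem_image_of_mem j x.2⟩) := by
      funext z
      by_cases hz : z ∈ U
      · refine (ext0_coe _ (⟨Φ z, (hΦ.mem_iff z).2 hz⟩ : U)).trans
          (Eq.trans ?_ (ext0_coe _ (⟨z, hz⟩ : U)).symm)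
        exact congrArg f (Subtype.ext (hΦ.map z))
      · have h0 (w : V) (hw : w ∉ U) (h : U → ℝ) : ext0 h w = 0 :=
          Function.extend_apply' _ _ _ (by rintro ⟨a, rfl⟩; exact hw a.2)
        rw [Function.comp_apply, h0 _ (by rwa [hΦ.mem_iff]), h0 _ hz]
    rw [← hxy']
    exact (σ.pb_comp_equiv Φ hΦ.form x (hinv f) (hinv g)).symm)
  exact ⟨cs, hman, π, hπ, hsub, hker⟩

end Symmetry

/-! ### Unitary actions and the fibres of the momentum maps -/

section Unitary

variable {n m : ℕ}

/-- Left multiplication by a unitary matrix. -/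
def mulLeftEquiv (m : ℕ) (A : Matrix (Fin n) (Fin n) ℂ) (hA : Aᴴ * A = 1) :
    Matrix (Fin n) (Fin m) ℂ ≃L[ℝ] Matrix (Fin n) (Fin m) ℂ :=
  LinearEquiv.toContinuousLinearEquiv
    { toFun := fun E => A * E
      invFun := fun E => Aᴴ * E
      map_add' := fun E F => Matrix.mul_add _ _ _
      map_smul' := fun r E => Matrix.mul_smul _ _ _
      left_inv := fun E => by
        simp only [← Matrix.mul_assoc, hA, Matrix.one_mul]
      right_inv := fun E => by
        simp only [← Matrix.mul_assoc, mul_eq_one_comm.1 hA, Matrix.one_mul] }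

/-- Right multiplication by a unitary matrix. -/
def mulRightEquiv (n : ℕ) (A : Matrix (Fin m) (Fin m) ℂ) (hA : Aᴴ * A = 1) :
    Matrix (Fin n) (Fin m) ℂ ≃L[ℝ] Matrix (Fin n) (Fin m) ℂ :=
  LinearEquiv.toContinuousLinearEquiv
    { toFun := fun E => E * A
      invFun := fun E => E * Aᴴ
      map_add' := fun E F => Matrix.add_mul _ _ _
      map_smul' := fun r E => Matrix.smul_mul _ _ _
      left_inv := fun E => by
        simp only [Matrix.mul_assoc, mul_eq_one_comm.1 hA, Matrix.mul_one]
      right_inv := fun E => by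
        simp only [Matrix.mul_assoc, hA, Matrix.mul_one] }

theorem gram_mul_left {A : Matrix (Fin n) (Fin n) ℂ} (hA : Aᴴ * A = 1)
    (E F : Matrix (Fin n) (Fin m) ℂ) : (A * E)ᴴ * (A * F) = Eᴴ * F := by
  rw [Matrix.conjTranspose_mul, Matrix.mul_assoc, ← Matrix.mul_assoc Aᴴ, hA, Matrix.one_mul]

theorem gram_mul_right {A : Matrix (Fin m) (Fin m) ℂ} (hA : Aᴴ * A = 1)
    (E F : Matrix (Fin n) (Fin m) ℂ) : (E * A) * (F * A)ᴴ = E * Fᴴ := by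
  rw [Matrix.conjTranspose_mul, Matrix.mul_assoc, ← Matrix.mul_assoc A, mul_eq_one_comm.1 hA,
    Matrix.one_mul]

theorem isSymmetry_mulLeftEquiv {A : Matrix (Fin n) (Fin n) ℂ} (hA : Aᴴ * A = 1) :
    IsSymmetry (Ω n m) (jR n m) (fullRankOpens n m) (mulLeftEquiv m A hA) where
  form v w := congrArg (fun X : Matrix (Fin m) (Fin m) ℂ => X.trace.im) (gram_mul_left hA v w)
  mem_iff z := by
    change A * z ∈ fullRank n m ↔ z ∈ fullRank n m
    rw [mem_fullRank_iff, mem_fullRank_iff, gram_mul_left hA]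
  map z := (jR_eq_iff _ _).2 (gram_mul_left hA z z)

theorem isSymmetry_mulRightEquiv {A : Matrix (Fin m) (Fin m) ℂ} (hA : Aᴴ * A = 1) :
    IsSymmetry (Ω n m) (jL n m) (fullRankOpens n m) (mulRightEquiv n A hA) where
  form v w := by
    change ((v * A)ᴴ * (w * A)).trace.im = (vᴴ * w).trace.im
    rw [Matrix.trace_mul_comm, Matrix.mul_assoc, ← Matrix.mul_assoc, gram_mul_right hA,
      Matrix.trace_mul_comm]
  mem_iff z := by
    change (z * A).rank = m ↔ z.rank = m
    rw [Matrix.rank_mul_eq_left_of_isUnit_det]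
    exact IsUnit.of_mul_eq_one_right Aᴴ.det (by rw [← Matrix.det_mul, hA, Matrix.det_one])
  map z := (jL_eq_iff _ _).2 (gram_mul_right hA z z)

/-- The fibres of `j_L` are orbits of the unitary group. -/
theorem exists_symmetry_jL {x y : Matrix (Fin n) (Fin m) ℂ} (hx : x ∈ fullRank n m)
    (hy : y ∈ fullRank n m) (h : jL n m x = jL n m y) :
    ∃ Φ, IsSymmetry (Ω n m) (jL n m) (fullRankOpens n m) Φ ∧ Φ x = y := by
  rw [jL_eq_iff] at h
  rw [mem_fullRank_iff] at hx hy
  obtain ⟨G, hG⟩ : ∃ G, (xᴴ * x)⁻¹ = G := ⟨_, rfl⟩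
  have hGx : G * (xᴴ * x) = 1 := by rw [← hG, Matrix.nonsing_inv_mul _ hx]
  have hxG : xᴴ * x * G = 1 := by rw [← hG, Matrix.mul_nonsing_inv _ hx]
  have hGs : Gᴴ = G := by
    rw [← hG, Matrix.conjTranspose_nonsing_inv, Matrix.conjTranspose_mul,
      Matrix.conjTranspose_conjTranspose]
  -- Gx† is a left inverse of x, so this is the only candidate for xA = y.
  let A := G * xᴴ * y
  have hA : A * Aᴴ = 1 := by
    calc A * Aᴴ = G * xᴴ * (y * yᴴ) * x * G := by
          simp only [A, Matrix.conjTranspose_mul, Matrix.conjTranspose_conjTranspose, hGs,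
            Matrix.mul_assoc]
      _ = (G * (xᴴ * x)) * (xᴴ * x * G) := by rw [← h]; simp only [Matrix.mul_assoc]
      _ = 1 := by rw [hGx, hxG, Matrix.one_mul]
  have hxA : x * A = y := by
    have h1 : x * A * (yᴴ * y) = y * (yᴴ * y) := by
      calc x * A * (yᴴ * y) = x * G * xᴴ * (y * yᴴ) * y := by simp only [A, Matrix.mul_assoc]
        _ = x * (G * (xᴴ * x)) * xᴴ * y := by rw [← h]; simp only [Matrix.mul_assoc]
        _ = x * xᴴ * y := by rw [hGx, Matrix.mul_one]
        _ = y * (yᴴ * y) := by rw [h, Matrix.mul_assoc]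
    have h2 := congrArg (fun X => X * (yᴴ * y)⁻¹) h1
    simpa only [Matrix.mul_nonsing_inv_cancel_right _ _ hy] using h2
  exact ⟨_, isSymmetry_mulRightEquiv (mul_eq_one_comm.1 hA), hxA⟩

theorem toEuclideanLin_mul_apply {k : ℕ} (A : Matrix (Fin n) (Fin m) ℂ)
    (B : Matrix (Fin m) (Fin k) ℂ) (v : EuclideanSpace ℂ (Fin k)) :
    Matrix.toEuclideanLin (A * B) v = Matrix.toEuclideanLin A (Matrix.toEuclideanLin B v) := by
  simp [Matrix.toLpLin_apply]

theorem toEuclideanLin_one_apply (v : EuclideanSpace ℂ (Fin n)) :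
    Matrix.toEuclideanLin (1 : Matrix (Fin n) (Fin n) ℂ) v = v := by
  simp

theorem inner_toEuclideanLin (z : Matrix (Fin n) (Fin m) ℂ) (u v : EuclideanSpace ℂ (Fin m)) :
    inner ℂ (Matrix.toEuclideanLin z u) (Matrix.toEuclideanLin z v) =
      inner ℂ u (Matrix.toEuclideanLin (zᴴ * z) v) := by
  rw [toEuclideanLin_mul_apply, Matrix.toEuclideanLin_conjTranspose_eq_adjoint,
    LinearMap.adjoint_inner_right]

/-- The fibres of `j_R` are orbits of the unitary group. -/
theorem exists_symmetry_jR {x y : Matrix (Fin n) (Fin m) ℂ} (hx : x ∈ fullRank n m)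
    (h : jR n m x = jR n m y) :
    ∃ Φ, IsSymmetry (Ω n m) (jR n m) (fullRankOpens n m) Φ ∧ Φ x = y := by
  rw [jR_eq_iff] at h
  rw [mem_fullRank_iff] at hx
  let f := Matrix.toEuclideanLin x
  let g := Matrix.toEuclideanLin y
  have hfg (u : EuclideanSpace ℂ (Fin m)) : ‖g u‖ = ‖f u‖ := by
    rw [@norm_eq_sqrt_re_inner ℂ, @norm_eq_sqrt_re_inner ℂ, inner_toEuclideanLin,
      inner_toEuclideanLin, h]
  have hf : Function.Injective f := by
    intro u v huv
    have h1 := congrArg (Matrix.toEuclideanLin ((xᴴ * x)⁻¹ * xᴴ)) huv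
    simpa only [f, ← toEuclideanLin_mul_apply, Matrix.mul_assoc, Matrix.nonsing_inv_mul _ hx,
      toEuclideanLin_one_apply] using h1
  -- Equal Gram matrices make xu ↦ yu a well-defined isometry on the range of x; in finite dimension
  -- it extends to a unitary of ℂⁿ.
  let L : LinearMap.range f →ₗᵢ[ℂ] EuclideanSpace ℂ (Fin n) :=
    { toLinearMap := g ∘ₗ (LinearEquiv.ofInjective f hf).symm.toLinearMap
      norm_map' := fun w => by
        obtain ⟨u, rfl⟩ := (LinearEquiv.ofInjective f hf).surjective w
        simpa using hfg u }
  have hL (u : EuclideanSpace ℂ (Fin m)) : L.extend (f u) = g u := by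
    have h1 := L.extend_apply (LinearEquiv.ofInjective f hf u)
    rw [LinearEquiv.ofInjective_apply] at h1
    rw [h1]
    change g ((LinearEquiv.ofInjective f hf).symm (LinearEquiv.ofInjective f hf u)) = g u
    rw [LinearEquiv.symm_apply_apply]
  let A : Matrix (Fin n) (Fin n) ℂ := Matrix.toEuclideanLin.symm L.extend.toLinearMap
  have hAL (w : EuclideanSpace ℂ (Fin n)) : Matrix.toEuclideanLin A w = L.extend w := by
    simp only [A, LinearEquiv.apply_symm_apply]; rfl
  have hA : Aᴴ * A = 1 := by
    apply Matrix.toEuclideanLin.injective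
    refine LinearMap.ext fun v => ext_inner_left ℂ fun u => ?_
    rw [← inner_toEuclideanLin, hAL, hAL, LinearIsometry.inner_map_map, toEuclideanLin_one_apply]
  refine ⟨_, isSymmetry_mulLeftEquiv hA, ?_⟩
  change A * x = y
  apply Matrix.toEuclideanLin.injective
  refine LinearMap.ext fun u => ?_
  rw [toEuclideanLin_mul_apply, hAL]
  exact hL u

end Unitary

end UnitaryDualPair

namespace UnitaryDualPair

/-! ### The dual pair at full rank, and its maximality -/

section Main

variable {n m : ℕ}

theorem defineLieWeinsteinOn_fullRank (n m : ℕ) :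
    DefineLieWeinsteinOn (Ω n m) (jL n m) (jR n m) (fullRank n m) := by
  refine ⟨isOpen_fullRank n m, ?_⟩
  obtain ⟨cs₁, hman₁, π₁, hπ₁, hsub₁, hker₁⟩ := exists_poisson_image (Ω n m)
    (U := fullRankOpens n m) contDiff_jL jLChart
    fun x hx y hy h => exists_symmetry_jL hx hy h
  obtain ⟨cs₂, hman₂, π₂, hπ₂, hsub₂, hker₂⟩ := exists_poisson_image (Ω n m)
    (U := fullRankOpens n m) contDiff_jR (fun x _ => jRChart n m x)
    fun x hx y _ h => exists_symmetry_jR hx h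
  have hsc (k : ℕ) : SecondCountableTopology (Skew k) := by
    have := FiniteDimensional.proper ℝ (Skew k)
    exact secondCountable_of_proper
  -- Both images carry the subspace topology, Hausdorff and second countable as inherited from 𝔲(n)
  -- and 𝔲(m).
  refine ⟨_, _, inferInstance, inferInstance, inferInstance, cs₁, hman₁, inferInstance,
    inferInstance, inferInstance, cs₂, hman₂, π₁, π₂, hπ₁, hπ₂, hsub₁, hsub₂, fun x => ?_⟩
  exact (congrArg (Ω n m).form.orthogonal (hker₁ x)).trans
    ((orthogonal_ker_fderiv_jL x.2).trans (hker₂ x).symm)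

open scoped ComplexOrder in
-- The contradiction uses only functionals constant on the fibres through E, since nothing is known
-- about how the manifold structures on the images relate to the matrix spaces.
theorem subset_fullRank_of_defineLieWeinsteinOn (hmn : m ≤ n) {S : Set (Matrix (Fin n) (Fin m) ℂ)}
    (hS : DefineLieWeinsteinOn (Ω n m) (jL n m) (jR n m) S) : S ⊆ fullRank n m := by
  obtain ⟨hSo, d₁, d₂, t₁, _, _, cs₁, hman₁, t₂, _, _, cs₂, hman₂, π₁, π₂, -, -, hsub₁, hsub₂,
    horth⟩ := hS
  intro E hES
  by_contra hrk
  have hlt : E.rank < m := lt_of_le_of_ne (Matrix.rank_le_width E) hrk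
  obtain ⟨B, hB, hEB⟩ := exists_mul_eq_zero_of_rank_lt hlt
  -- m ≤ n enters here: E† has n columns and rank below m ≤ n, hence a nonzero null vector.
  obtain ⟨A, hA, hEA⟩ := exists_mul_eq_zero_of_rank_lt (E := Eᴴ)
    (by rw [Matrix.rank_conjTranspose]; omega)
  let U : TopologicalSpace.Opens (Matrix (Fin n) (Fin m) ℂ) := ⟨S, hSo⟩
  let x : U := ⟨E, hES⟩
  let J₁ : U → jL n m '' S := fun x => ⟨jL n m x, Set.mem_image_of_mem _ x.2⟩
  let v : Matrix (Fin n) (Fin m) ℂ := A * Bᴴ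
  let form : Matrix (Fin n) (Fin m) ℂ →ₗ[ℝ] Matrix (Fin n) (Fin m) ℂ →ₗ[ℝ] ℝ := (Ω n m).form
  have hv₁ : v ∈ (Ω n m).form.orthogonal (kerTangent d₁ J₁ x) := by
    rw [LinearMap.BilinForm.mem_orthogonal_iff]
    intro w hw
    have hzero (y : Matrix (Fin n) (Fin m) ℂ) (hy : yᴴ * A = 0) : form y v = 0 := by
      change (yᴴ * (A * Bᴴ)).trace.im = 0
      rw [← Matrix.mul_assoc, hy, Matrix.zero_mul, Matrix.trace_zero, Complex.zero_im]
    refine eq_zero_of_mfderiv_eq_zero (hsub₁.2.1 x) (hsub₁.2.2 x)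
      (LinearMap.toContinuousLinearMap (form.flip v)) (fun y hy => ?_) hw
    have hy' := (jL_eq_iff _ _).1 (congrArg Subtype.val hy)
    refine (hzero y ?_).trans (hzero E hEA).symm
    -- y†A = 0 is equivalent to yy†A = 0, and yy† = EE† on the fibre.
    rw [← Matrix.self_mul_conjTranspose_mul_eq_zero, hy', Matrix.mul_assoc, hEA, Matrix.mul_zero]
  have hv₂ := (horth x).le hv₁
  have hzero (y : Matrix (Fin n) (Fin m) ℂ) (hy : y * B = 0) : form (Complex.I • v) y = 0 := by
    change ((Complex.I • (A * Bᴴ))ᴴ * y).trace.im = 0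
    have : ((A * Bᴴ)ᴴ * y).trace = 0 := by
      rw [Matrix.trace_mul_comm, Matrix.conjTranspose_mul, Matrix.conjTranspose_conjTranspose,
        ← Matrix.mul_assoc, hy, Matrix.zero_mul, Matrix.trace_zero]
    rw [Matrix.conjTranspose_smul, Matrix.smul_mul, Matrix.trace_smul, this, smul_zero,
      Complex.zero_im]
  have h1 : form (Complex.I • v) v = 0 := by
    refine eq_zero_of_mfderiv_eq_zero (hsub₂.2.1 x) (hsub₂.2.2 x)
      (LinearMap.toContinuousLinearMap (form (Complex.I • v))) (fun y hy => ?_) hv₂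
    have hy' := (jR_eq_iff _ _).1 (congrArg Subtype.val hy)
    refine (hzero y ?_).trans (hzero E hEB).symm
    rw [← Matrix.conjTranspose_mul_self_mul_eq_zero, hy', Matrix.mul_assoc, hEB, Matrix.mul_zero]
  have h2 : (vᴴ * v).trace.re = 0 := by
    change ((Complex.I • v)ᴴ * v).trace.im = 0 at h1
    rw [Matrix.conjTranspose_smul, Matrix.smul_mul, Matrix.trace_smul] at h1
    simpa using h1
  have h3 : v = 0 := Matrix.trace_conjTranspose_mul_self_eq_zero_iff.1
    (Complex.ext h2 (imTraceForm_isAlt n m v))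
  obtain ⟨i, hi⟩ : ∃ i, A i 0 ≠ 0 := by
    by_contra! h
    exact hA (Matrix.ext fun i j => by rw [Subsingleton.elim j 0, h]; rfl)
  obtain ⟨j, hj⟩ : ∃ j, B j 0 ≠ 0 := by
    by_contra! h
    exact hB (Matrix.ext fun i j => by rw [Subsingleton.elim j 0, h]; rfl)
  have h4 : v i j = 0 := by rw [h3]; rfl
  -- The entry v i j is A i 0 times the conjugate of B j 0, a product of nonzero numbers.
  simp [v, Matrix.mul_apply, hi, hj] at h4

end Main

end UnitaryDualPair

end

theorem mainTheorem10 (n m : ℕ) (hmn : m ≤ n) :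
    IsOpen (UnitaryDualPair.fullRank n m) ∧
    IsGreatest {S : Set (Matrix (Fin n) (Fin m) ℂ) |
        UnitaryDualPair.DefineLieWeinsteinOn (UnitaryDualPair.Ω n m)
          (UnitaryDualPair.jL n m) (UnitaryDualPair.jR n m) S}
      (UnitaryDualPair.fullRank n m) ∧
    Differentiable ℝ (UnitaryDualPair.jR n m) ∧
    (∀ E ∈ UnitaryDualPair.fullRank n m,
      UnitaryDualPair.rankTjR n m E = m ^ 2) ∧
    (∀ E : Matrix (Fin n) (Fin m) ℂ, E.rank < m →
      UnitaryDualPair.rankTjR n m E < m ^ 2) :=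
  ⟨UnitaryDualPair.isOpen_fullRank n m,
    ⟨UnitaryDualPair.defineLieWeinsteinOn_fullRank n m,
      fun _ hS => UnitaryDualPair.subset_fullRank_of_defineLieWeinsteinOn hmn hS⟩,
    (UnitaryDualPair.contDiff_jR (r := 1)).differentiable (by simp),
    fun _ hE => UnitaryDualPair.rankTjR_of_mem_fullRank hE,
    fun _ hE => UnitaryDualPair.rankTjR_lt_of_rank_lt hE⟩
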